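/- For $0<\phi<\pi/2$ and $\eta>0$ let $\Delta(\phi,\eta)=\{z\in\mathbb{C}: |z|<1+\eta,\ |\operatorname{Arg}(z-1)|>\phi\}$. Call $f$ $\Delta$-regular in $\Delta(\phi,\eta)$ if its Taylor series $\sum_{n\ge0} f_nz^n$ at $0$ has radius of convergence $1$ and $f$ is analytic in $\Delta(\phi,\eta)$. The Hadamard product of $f(z)=\sum_n f_nz^n$ and $g(z)=\sum_n g_nz^n$ is $(f\odot g)(z)=\sum_{n\ge0} f_ng_nz^n$. Put $L(z)=\log\frac1{1-z}$ (principal branch). Let $f,g$ be $\Delta$-regular in $\Delta=\Delta(\phi,\eta)$, and let $a,b$ be real numbers with $a+b+1>-1$ such that, uniformly for $z\in\Delta$, $f(z)=O(|1-z|^a)$ and $g(z)=O(|1-z|^b)$. Then there is a (possibly smaller) domain $\Delta'=\Delta(\phi',\eta')\subseteq\Delta$, with $\phi\le\phi'<\pi/2$ and $0<\eta'\le\eta$, to which $f\odot g$ continues analytically, such that the following holds, where $(f\odot g)^{(j)}(1)$ denotes the limit of $(f\odot g)^{(j)}(z)$ as $z\to1$ in $\Delta'$. (i) If $k<a+b+1<k+1$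 for some integer $k\ge-1$, then $(f\odot g)^{(j)}(1)$ exists for $0\le j\le k$ and, uniformly for $z\in\Delta'$, $$(f\odot g)(z)=\sum_{j=0}^{k}\frac{(-1)^j}{j!}(f\odot g)^{(j)}(1)\,(1-z)^j+O\left(|1-z|^{a+b+1}\right).$$ (ii) If $a+b+1$ is a nonnegative integer, then $(f\odot g)^{(j)}(1)$ exists for $0\le j\le a+b$ and, for every $r>0$, uniformly for $z\in\Delta'$ with $|z|\ge r$, $$(f\odot g)(z)=\sum_{j=0}^{a+b}\frac{(-1)^j}{j!}(f\odot g)^{(j)}(1)\,(1-z)^j+O\left(|1-z|^{a+b+1}|L(z)|\right).$$ (Empty sums are $0$.) -/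

import Mathlib

open Filter Topology Asymptotics

namespace HadamardSing

/-- The domain `Δ(φ, η) = {z : |z| < 1 + η, |Arg (z - 1)| > φ}`.  As `Complex.arg 0 = 0`, it does
not contain the point `1` when `0 ≤ φ`. -/
def deltaDomain (φ η : ℝ) : Set ℂ :=
  {z : ℂ | ‖z‖ < 1 + η ∧ φ < |Complex.arg (z - 1)|}

/-- The `n`-th Taylor coefficient at the origin, `[zⁿ] f(z)`. -/
noncomputable def taylorCoeff (f : ℂ → ℂ) (n : ℕ) : ℂ :=
  iteratedDeriv n f 0 / (n.factorial : ℂ)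

/-- `f` is `Δ`-regular in `Δ(φ, η)`: its Taylor series at the origin has radius of convergence
equal to `1`, and `f` is analytic on `Δ(φ, η)` (a set that contains the open unit disc). The values
of `f` outside `Δ(φ, η)` play no role. -/
structure IsDeltaRegular (f : ℂ → ℂ) (φ η : ℝ) : Prop where
  eta_pos : 0 < η
  phi_pos : 0 < φ
  phi_lt : φ < Real.pi / 2
  radius_eq : (FormalMultilinearSeries.ofScalars ℂ (taylorCoeff f)).radius = 1
  analytic : AnalyticOnNhd ℂ f (deltaDomain φ η)

/-- The function `h` is (the analytic continuation to `D` of) the Hadamard product `f ⊙ g`: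
it is analytic on `D` and on the open unit disc it is the sum of `∑ fₙ gₙ zⁿ`. -/
structure IsHadamardProductOn (f g h : ℂ → ℂ) (D : Set ℂ) : Prop where
  analytic : AnalyticOnNhd ℂ h D
  hasSum : ∀ z ∈ Metric.ball (0 : ℂ) 1,
    HasSum (fun n : ℕ => taylorCoeff f n * taylorCoeff g n * z ^ n) (h z)

/-- `d` is the value `h⁽ʲ⁾(1)` at the boundary point `1` of `D`: the limit of the `j`-th derivative
of `h` as `z → 1` within `D`. -/
def HasDerivValueAtOne (h : ℂ → ℂ) (D : Set ℂ) (j : ℕ) (d : ℂ) : Prop :=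
  Tendsto (iteratedDeriv j h) (𝓝[D] 1) (𝓝 d)

/-- The Taylor polynomial at `1` with the `m` derivatives `d 0, …, d (m - 1)`:
`∑_{j < m} (-1)ʲ / j! * d j * (1 - z)ʲ`. -/
noncomputable def taylorPolyAtOne (d : ℕ → ℂ) (m : ℕ) (z : ℂ) : ℂ :=
  ∑ j ∈ Finset.range m, (-1) ^ j / (j.factorial : ℂ) * d j * (1 - z) ^ j

/-- `L(z) = log (1 / (1 - z))`, principal branch. -/
noncomputable def L (z : ℂ) : ℂ := Complex.log (1 / (1 - z))

end HadamardSing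

/-!
Write `f ⊙ g (z) = (2πi)⁻¹ ∫ f(w) g(z / w) dw / w`. The contour is the closed spiral
`w(θ) = exp (2κ · 2 sin (θ / 2) + iθ)`, which leaves the unit circle at the singularity `1` and
returns to it. Assuming `a > -1`, as we may because the product is symmetric and `a + b > -2`,
`f` is integrable along it, and Cauchy's formula through the singularity is the limit of the formula
on the dilated contours `exp s · w`, `s → 0⁻`. If `z` is in a smaller domain of the same shape, then
`z / w` stays in the domain of `g` and `|1 - z / w|` is comparable to `|1 - z| + |1 - w|`. With
Cauchy's estimates for the derivatives of `g`, the `j`-th derivative of the integral is therefore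
bounded by `∫ t ^ a * (|1 - z| + t) ^ (b - j) dt`, which converges at `z = 1` when `j < a + b + 1`,
is `O(|1 - z| ^ (a + b + 1 - j))` when `j > a + b + 1`, and is logarithmic in between. Integrating
the bound for the first derivative of order at least `a + b + 1` back to `1` along segments gives
both expansions.
-/

namespace HadamardSing

open MeasureTheory

lemma rpow_le_rpow_add_rpow {m y M : ℝ} (hm : 0 < m) (hmy : m ≤ y) (hyM : y ≤ M) (e : ℝ) :
    y ^ e ≤ m ^ e + M ^ e := by
  have hy := hm.trans_le hmy
  have hM := hy.trans_le hyM
  rcases le_total 0 e with he | he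
  · linarith [Real.rpow_le_rpow hy.le hyM he, Real.rpow_nonneg hm.le e]
  · linarith [Real.rpow_le_rpow_of_nonpos hm hmy he, Real.rpow_nonneg hM.le e]

lemma rpow_le_of_comparable {K x y : ℝ} (hK : 0 < K) (hy : 0 < y) (hxy : x ≤ K * y)
    (hyx : y ≤ K * x) (e : ℝ) : x ^ e ≤ (K⁻¹ ^ e + K ^ e) * y ^ e := by
  have h := rpow_le_rpow_add_rpow (by positivity) ((inv_mul_le_iff₀ hK).2 hyx) hxy e
  rwa [Real.mul_rpow (by positivity) hy.le, Real.mul_rpow hK.le hy.le, ← add_mul] at h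

lemma exp_le_one_add_two_mul {x : ℝ} (hx : 0 ≤ x) (hx1 : x ≤ 1) : Real.exp x ≤ 1 + 2 * x := by
  have h := Real.abs_exp_sub_one_le (x := x) (by rwa [abs_of_nonneg hx])
  rw [abs_of_nonneg hx] at h
  linarith [le_abs_self (Real.exp x - 1)]

/-! ### Cones and spiral domains at `1` -/

/-- `deltaDomain φ η` with the angular condition `φ < |arg (z - 1)|` in the algebraic form
`re (z - 1) < cos φ * |z - 1|`. -/
def coneDomain (c η : ℝ) : Set ℂ :=
  {z : ℂ | ‖z‖ < 1 + η ∧ z.re - 1 < c * ‖1 - z‖}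

lemma deltaDomain_eq_coneDomain {φ : ℝ} (hφ : 0 ≤ φ) (hφπ : φ ≤ Real.pi) (η : ℝ) :
    deltaDomain φ η = coneDomain (Real.cos φ) η := by
  ext z
  refine and_congr_right fun _ => ?_
  rcases eq_or_ne z 1 with rfl | hz
  · simp [hφ]
  · rw [← Real.strictAntiOn_cos.lt_iff_gt ⟨abs_nonneg _, Complex.abs_arg_le_pi _⟩ ⟨hφ, hφπ⟩,
      Real.cos_abs, Complex.cos_arg (sub_ne_zero.2 hz),
      div_lt_iff₀ (norm_pos_iff.2 (sub_ne_zero.2 hz)), norm_sub_rev z, Complex.sub_re,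
      Complex.one_re]

section coneDomain

variable {c c' η η' : ℝ}

lemma isOpen_coneDomain (c η : ℝ) : IsOpen (coneDomain c η) :=
  IsOpen.and (isOpen_lt (by fun_prop) (by fun_prop)) (isOpen_lt (by fun_prop) (by fun_prop))

lemma one_notMem_coneDomain (c η : ℝ) : (1 : ℂ) ∉ coneDomain c η := by
  simp [coneDomain]

lemma coneDomain_mono (hc : c ≤ c') (hη : η ≤ η') : coneDomain c η ⊆ coneDomain c' η' :=
  fun _ hz => ⟨by linarith [hz.1], hz.2.trans_le (by gcongr)⟩

lemma openSegment_one_subset_coneDomain (hη : 0 < η) {z : ℂ} (hz : z ∈ coneDomain c η) :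
    openSegment ℝ 1 z ⊆ coneDomain c η := by
  rintro _ ⟨s, t, hs, ht, hst, rfl⟩
  have hsub : 1 - (s • (1 : ℂ) + t • z) = t • (1 - z) := by
    rw [smul_sub, eq_sub_of_add_eq hst, sub_smul, one_smul]; abel
  have hre : (s • (1 : ℂ) + t • z).re - 1 = t * (z.re - 1) := by
    rw [eq_sub_of_add_eq hst]; simp; ring
  refine ⟨?_, ?_⟩
  · calc ‖s • (1 : ℂ) + t • z‖ ≤ ‖s • (1 : ℂ)‖ + ‖t • z‖ := norm_add_le _ _
      _ = s + t * ‖z‖ := by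
        rw [norm_smul_of_nonneg hs.le, norm_smul_of_nonneg ht.le, norm_one, mul_one]
      _ < 1 + η := by nlinarith [hz.1, mul_lt_mul_of_pos_left hz.1 ht]
  · rw [hsub, hre, norm_smul_of_nonneg ht.le, mul_left_comm]
    exact mul_lt_mul_of_pos_left hz.2 ht

lemma closedBall_subset_coneDomain {δ : ℝ} (hδ : 0 ≤ δ) (hc : 0 ≤ c) (hcδ : c' + δ ≤ c * (1 - δ))
    (hηδ : η' + δ * (2 + η') ≤ η) {z : ℂ} (hz : z ∈ coneDomain c' η') :
    Metric.closedBall z (δ * ‖1 - z‖) ⊆ coneDomain c η := by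
  intro w hw
  have hwz : ‖w - z‖ ≤ δ * ‖1 - z‖ := mem_closedBall_iff_norm.1 hw
  have hz1 : ‖1 - z‖ ≤ 2 + η' := by
    linarith [norm_sub_le (1 : ℂ) z, norm_one (α := ℂ), hz.1]
  have hw1 : (1 - δ) * ‖1 - z‖ ≤ ‖1 - w‖ := by
    have := norm_sub_norm_le (1 - z) (w - z)
    rw [sub_sub_sub_cancel_right] at this
    linarith
  refine ⟨?_, ?_⟩
  · have := norm_sub_norm_le w z
    linarith [hz.1, mul_le_mul_of_nonneg_left hz1 hδ]
  · have hre : w.re - z.re ≤ ‖w - z‖ := Complex.re_le_norm (w - z)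
    calc w.re - 1 ≤ (z.re - 1) + δ * ‖1 - z‖ := by linarith
      _ < (c' + δ) * ‖1 - z‖ := by linarith [hz.2]
      _ ≤ c * ((1 - δ) * ‖1 - z‖) := by
        rw [← mul_assoc]; gcongr
      _ ≤ c * ‖1 - w‖ := by gcongr

end coneDomain

/-- The distance from `1` to the radial projection of `z` on the unit circle, that is
`2 * |sin (arg z / 2)|`; the value at `0` is `1`. -/
noncomputable def chord (z : ℂ) : ℝ := ‖1 - z / ‖z‖‖

section chord

variable (z w : ℂ)

lemma norm_div_norm_le_one : ‖z / ‖z‖‖ ≤ 1 := by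
  rw [norm_div, Complex.norm_real, norm_norm]
  exact div_self_le_one _

lemma norm_mul_div_norm : ‖z‖ * (z / ‖z‖) = z := by
  rcases eq_or_ne z 0 with rfl | hz
  · simp
  · exact mul_div_cancel₀ _ (by simpa using hz)

lemma chord_nonneg : 0 ≤ chord z := norm_nonneg _

lemma chord_le_two : chord z ≤ 2 := by
  have h := norm_sub_le 1 (z / ‖z‖)
  rw [norm_one] at h
  exact h.trans (by linarith [norm_div_norm_le_one z])

lemma chord_mul_le : chord (z * w) ≤ chord z + chord w := by
  have h : 1 - z * w / ‖z * w‖ = (1 - z / ‖z‖) + z / ‖z‖ * (1 - w / ‖w‖) := by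
    rw [norm_mul, Complex.ofReal_mul, mul_div_mul_comm]; ring
  rw [chord, h]
  refine (norm_add_le _ _).trans (add_le_add_right ?_ _)
  rw [norm_mul]
  exact mul_le_of_le_one_left (norm_nonneg _) (norm_div_norm_le_one z)

lemma norm_one_sub_le_add_chord : ‖1 - z‖ ≤ |1 - ‖z‖| + chord z := by
  have h : 1 - z = ((1 - ‖z‖ : ℝ) : ℂ) * (z / ‖z‖) + (1 - z / ‖z‖) := by
    push_cast
    linear_combination norm_mul_div_norm z
  rw [h]
  refine (norm_add_le _ _).trans (add_le_add_left ?_ _)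
  rw [norm_mul, Complex.norm_real, Real.norm_eq_abs]
  exact mul_le_of_le_one_right (abs_nonneg _) (norm_div_norm_le_one z)

lemma chord_le_two_mul_norm_one_sub : chord z ≤ 2 * ‖1 - z‖ := by
  have h : 1 - z / ‖z‖ = (1 - z) - ((1 - ‖z‖ : ℝ) : ℂ) * (z / ‖z‖) := by
    push_cast
    linear_combination -norm_mul_div_norm z
  have habs : |1 - ‖z‖| ≤ ‖1 - z‖ := by simpa using abs_norm_sub_norm_le 1 z
  calc chord z ≤ ‖1 - z‖ + |1 - ‖z‖| * ‖z / ‖z‖‖ := by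
        rw [chord, h]
        refine (norm_sub_le _ _).trans_eq ?_
        rw [norm_mul, Complex.norm_real, Real.norm_eq_abs]
    _ ≤ ‖1 - z‖ + ‖1 - z‖ * 1 := by gcongr; exact norm_div_norm_le_one z
    _ = 2 * ‖1 - z‖ := by ring

lemma re_eq_norm_mul_one_sub_chord : z.re = ‖z‖ * (1 - chord z ^ 2 / 2) := by
  rcases eq_or_ne z 0 with rfl | hz
  · simp
  · have hz' : ‖z‖ ≠ 0 := norm_ne_zero_iff.2 hz
    have hsq : z.re ^ 2 + z.im ^ 2 = ‖z‖ ^ 2 := by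
      rw [← Complex.normSq_eq_norm_sq, Complex.normSq_apply]; ring
    rw [chord, ← Complex.normSq_eq_norm_sq, Complex.normSq_apply]
    simp only [Complex.sub_re, Complex.one_re, Complex.div_ofReal_re, Complex.sub_im,
      Complex.one_im, Complex.div_ofReal_im]
    field_simp
    linear_combination hsq

lemma chord_exp (v : ℂ) : chord (Complex.exp v) = |2 * Real.sin (v.im / 2)| := by
  have h : Complex.exp v / ‖Complex.exp v‖ = Complex.exp (Complex.I * v.im) := by
    rw [Complex.norm_exp, Complex.ofReal_exp, ← Complex.exp_sub]
    congr 1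
    linear_combination -Complex.re_add_im v
  rw [chord, h, norm_sub_rev, Complex.norm_exp_I_mul_ofReal_sub_one, Real.norm_eq_abs]

end chord

/-- The region inside the closed curve formed by two logarithmic-type spirals meeting at `1`, the
curve being given in polar form by `r = exp (κ * chord)`. -/
def spiralDomain (κ : ℝ) : Set ℂ := {z : ℂ | ‖z‖ < Real.exp (κ * chord z)}

/-- The region `spiralDomain κ` together with its bounding curve, hence with the point `1`. -/
def spiralClosure (κ : ℝ) : Set ℂ := {z : ℂ | ‖z‖ ≤ Real.exp (κ * chord z)}

section spiralDomain

variable {κ c η : ℝ}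

lemma spiralDomain_subset_coneDomain (hκ : 0 ≤ κ) (hκ1 : 2 * κ ≤ 1) (hc : 4 * κ ≤ c)
    (hη : 4 * κ ≤ η) : spiralDomain κ ⊆ coneDomain c η := by
  intro z (hz : ‖z‖ < _)
  have hx : 0 ≤ κ * chord z := mul_nonneg hκ (chord_nonneg z)
  have hx2 : κ * chord z ≤ κ * 2 := by gcongr; exact chord_le_two z
  have hlt : ‖z‖ < 1 + 2 * (κ * chord z) :=
    hz.trans_le (exp_le_one_add_two_mul hx (by linarith))
  refine ⟨by linarith, ?_⟩
  calc z.re - 1 < 2 * (κ * chord z) := by linarith [Complex.re_le_norm z]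
    _ ≤ 2 * (κ * (2 * ‖1 - z‖)) := by gcongr; exact chord_le_two_mul_norm_one_sub z
    _ = 4 * κ * ‖1 - z‖ := by ring
    _ ≤ c * ‖1 - z‖ := by gcongr

lemma coneDomain_subset_spiralClosure (hκ : 0 < κ) (hκ1 : κ ≤ 1) :
    coneDomain (κ / 4) (κ ^ 2 / 4) ⊆ spiralClosure κ := by
  intro z hz
  have ha := chord_nonneg z
  suffices h : ‖z‖ - 1 ≤ κ * chord z from
    (by linarith : ‖z‖ ≤ κ * chord z + 1).trans (Real.add_one_le_exp _)
  by_contra! hlt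
  have hpos : 0 < ‖z‖ - 1 := (mul_nonneg hκ.le ha).trans_lt hlt
  have hchord : chord z < κ / 4 := by
    refine lt_of_mul_lt_mul_left ?_ hκ.le
    nlinarith [hz.1]
  have hnorm : ‖1 - z‖ ≤ (‖z‖ - 1) + chord z := by
    simpa only [abs_sub_comm, abs_of_pos hpos] using norm_one_sub_le_add_chord z
  have hle2 : ‖z‖ ≤ 2 := by nlinarith [hz.1]
  have hlinear : (1 - κ / 4) * (‖z‖ - 1) < κ / 2 * chord z := by
    have hre := hz.2
    rw [re_eq_norm_mul_one_sub_chord] at hre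
    have h1 : ‖z‖ * chord z ^ 2 ≤ 2 * (κ / 4 * chord z) := by
      rw [sq]; gcongr
    linarith [mul_le_mul_of_nonneg_left hnorm (by linarith : (0 : ℝ) ≤ κ / 4)]
  have : (1 - κ / 4) * (κ * chord z) < κ / 2 * chord z :=
    (mul_le_mul_of_nonneg_left hlt.le (by linarith)).trans_lt hlinear
  nlinarith [mul_nonneg hκ.le ha]

lemma one_mem_spiralClosure (κ : ℝ) : (1 : ℂ) ∈ spiralClosure κ := by
  simp [spiralClosure, chord]

end spiralDomain

section quotient

variable {κ : ℝ} {z w : ℂ}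

lemma norm_one_sub_le_two_mul_chord (hκ : 0 ≤ κ) (hκ1 : 2 * κ ≤ 1)
    (hw : ‖w‖ = Real.exp (κ * chord w)) : ‖1 - w‖ ≤ 2 * chord w := by
  have hx : 0 ≤ κ * chord w := mul_nonneg hκ (chord_nonneg w)
  have hx1 : 2 * (κ * chord w) ≤ chord w := by
    rw [← mul_assoc]
    exact mul_le_of_le_one_left (chord_nonneg w) hκ1
  have h := norm_one_sub_le_add_chord w
  rw [hw, abs_sub_comm, abs_of_nonneg (by linarith [Real.one_le_exp hx])] at h
  linarith [exp_le_one_add_two_mul hx (by linarith [chord_le_two w])]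

lemma norm_div_le_exp (hκ : 0 ≤ κ) (hw : ‖w‖ = Real.exp (2 * κ * chord w))
    (hz : z ∈ spiralClosure κ) : ‖z / w‖ ≤ Real.exp (κ * (chord (z / w) - chord w)) := by
  have hw0 : w ≠ 0 := norm_ne_zero_iff.1 (hw ▸ (Real.exp_pos _).ne')
  have hchord : chord z ≤ chord (z / w) + chord w := by
    simpa only [div_mul_cancel₀ z hw0] using chord_mul_le (z / w) w
  rw [norm_div, hw, div_le_iff₀ (Real.exp_pos _), ← Real.exp_add]
  refine hz.trans (Real.exp_le_exp.2 ?_)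
  linarith [mul_le_mul_of_nonneg_left hchord hκ]

lemma div_mem_spiralDomain (hκ : 0 < κ) (hw : ‖w‖ = Real.exp (2 * κ * chord w))
    (hw1 : 0 < chord w) (hz : z ∈ spiralClosure κ) : z / w ∈ spiralDomain κ :=
  (norm_div_le_exp hκ.le hw hz).trans_lt
    (Real.exp_lt_exp.2 (by gcongr; linarith))

lemma chord_le_norm_one_sub_div (hκ : 0 < κ) (hκ1 : κ ≤ 1)
    (hw : ‖w‖ = Real.exp (2 * κ * chord w)) (hz : z ∈ spiralClosure κ) :
    chord w ≤ 4 / κ * ‖1 - z / w‖ := by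
  rw [div_mul_eq_mul_div, le_div_iff₀ hκ]
  rcases le_total (chord w) (2 * chord (z / w)) with h | h
  · have := chord_le_two_mul_norm_one_sub (z / w)
    calc chord w * κ ≤ chord w * 1 := by gcongr; exact chord_nonneg w
      _ ≤ 4 * ‖1 - z / w‖ := by linarith
  · -- Here `z / w` lies well inside the unit disc, at distance `≳ κ * chord w` from its boundary.
    set x : ℝ := κ * chord w / 2
    have hx0 : 0 ≤ x := by have := chord_nonneg w; positivity
    have hx1 : x ≤ 1 := by
      have : κ * chord w ≤ 1 * 2 := mul_le_mul hκ1 (chord_le_two w) (chord_nonneg w) one_pos.le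
      simp only [x]; linarith
    have hnorm : ‖z / w‖ ≤ Real.exp (-x) := by
      refine (norm_div_le_exp hκ.le hw hz).trans (Real.exp_le_exp.2 ?_)
      have := mul_le_mul_of_nonneg_left h hκ.le
      simp only [x]; linarith
    have hexp : Real.exp (-x) ≤ 1 - x / 2 := by
      rw [Real.exp_neg]
      refine inv_le_of_inv_le₀ (by linarith) ?_
      refine (?_ : _ ≤ 1 + x).trans (by linarith [Real.add_one_le_exp x])
      rw [inv_le_iff_one_le_mul₀ (by linarith)]
      nlinarith
    have := norm_sub_norm_le 1 (z / w)
    rw [norm_one] at this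
    simp only [x] at *
    linarith

lemma add_chord_comparable_norm_one_sub_div (hκ : 0 < κ) (hκ1 : 4 * κ ≤ 1)
    (hw : ‖w‖ = Real.exp (2 * κ * chord w)) (hz : z ∈ spiralClosure κ) :
    ‖1 - z‖ + chord w ≤ 15 / κ * ‖1 - z / w‖ ∧ ‖1 - z / w‖ ≤ 15 / κ * (‖1 - z‖ + chord w) := by
  have hw0 : w ≠ 0 := norm_ne_zero_iff.1 (hw ▸ (Real.exp_pos _).ne')
  have hx0 : 0 ≤ 2 * κ * chord w := by have := chord_nonneg w; positivity
  have hx1 : 2 * κ * chord w ≤ 1 := by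
    have : 2 * κ * chord w ≤ 2 * κ * 2 := by gcongr; exact chord_le_two w
    linarith
  have hw1 : 1 ≤ ‖w‖ := hw ▸ Real.one_le_exp hx0
  have hw3 : ‖w‖ ≤ 3 := by linarith [exp_le_one_add_two_mul hx0 hx1]
  have h1w : ‖1 - w‖ ≤ 2 * chord w := norm_one_sub_le_two_mul_chord (by positivity) (by linarith) hw
  have hmul : w * (1 - z / w) = w - z := by rw [mul_sub, mul_div_cancel₀ z hw0, mul_one]
  have hnorm : ‖w‖ * ‖1 - z / w‖ = ‖w - z‖ := by rw [← norm_mul, hmul]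
  have hκ' : 12 / κ + 3 ≤ 15 / κ := by
    rw [le_div_iff₀ hκ, add_mul, div_mul_cancel₀ _ hκ.ne']; linarith
  constructor
  · have hz1 : ‖1 - z‖ ≤ ‖1 - w‖ + ‖w - z‖ := norm_sub_le_norm_sub_add_norm_sub _ _ _
    have hwz : ‖w - z‖ ≤ 3 * ‖1 - z / w‖ := by rw [← hnorm]; gcongr
    have hchord := chord_le_norm_one_sub_div hκ (by linarith) hw hz
    calc ‖1 - z‖ + chord w ≤ 3 * (4 / κ * ‖1 - z / w‖) + 3 * ‖1 - z / w‖ := by linarith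
      _ = (12 / κ + 3) * ‖1 - z / w‖ := by ring
      _ ≤ 15 / κ * ‖1 - z / w‖ := by gcongr
  · have hwz : ‖w - z‖ ≤ ‖1 - w‖ + ‖1 - z‖ := by
      rw [norm_sub_rev 1 w]; exact norm_sub_le_norm_sub_add_norm_sub _ _ _
    calc ‖1 - z / w‖ ≤ ‖w - z‖ := by
          rw [← hnorm]; exact le_mul_of_one_le_left (norm_nonneg _) hw1
      _ ≤ 3 * (‖1 - z‖ + chord w) := by linarith [norm_nonneg (1 - z), chord_nonneg w]
      _ ≤ 15 / κ * (‖1 - z‖ + chord w) := by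
        gcongr
        · have := chord_nonneg w; positivity
        · linarith [div_nonneg (by norm_num : (0 : ℝ) ≤ 12) hκ.le]

end quotient

/-- The length of the chord of the unit circle that subtends the angle `θ`. -/
noncomputable def arcChord (θ : ℝ) : ℝ := 2 * Real.sin (θ / 2)

/-- The closed curve `r = exp (κ * chord)` through `1`, parametrized on `[0, 2π]` by the angle. -/
noncomputable def spiral (κ θ : ℝ) : ℂ := Complex.exp (κ * arcChord θ + θ * Complex.I)

section spiral

variable {κ θ : ℝ}

lemma arcChord_zero : arcChord 0 = 0 := by simp [arcChord]

lemma arcChord_two_pi : arcChord (2 * Real.pi) = 0 := by simp [arcChord]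

lemma arcChord_nonneg (hθ : θ ∈ Set.Icc 0 (2 * Real.pi)) : 0 ≤ arcChord θ :=
  mul_nonneg zero_le_two (Real.sin_nonneg_of_nonneg_of_le_pi (by linarith [hθ.1])
    (by linarith [hθ.2]))

lemma arcChord_pos (hθ : θ ∈ Set.Ioo 0 (2 * Real.pi)) : 0 < arcChord θ :=
  mul_pos two_pos (Real.sin_pos_of_pos_of_lt_pi (by linarith [hθ.1]) (by linarith [hθ.2]))

lemma hasDerivAt_arcChord (θ : ℝ) : HasDerivAt arcChord (Real.cos (θ / 2)) θ :=
  (((hasDerivAt_id' θ).div_const 2).sin.const_mul 2).congr_deriv (by ring)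

lemma continuous_arcChord : Continuous arcChord := by
  unfold arcChord; fun_prop

lemma continuous_spiral (κ : ℝ) : Continuous (spiral κ) := by
  have := continuous_arcChord
  unfold spiral; fun_prop

lemma spiral_ne_zero (κ θ : ℝ) : spiral κ θ ≠ 0 := Complex.exp_ne_zero _

lemma norm_spiral (κ θ : ℝ) : ‖spiral κ θ‖ = Real.exp (κ * arcChord θ) := by
  simp [spiral, Complex.norm_exp]

lemma one_le_norm_spiral (hκ : 0 ≤ κ) (hθ : θ ∈ Set.Icc 0 (2 * Real.pi)) : 1 ≤ ‖spiral κ θ‖ := by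
  rw [norm_spiral]
  exact Real.one_le_exp (mul_nonneg hκ (arcChord_nonneg hθ))

lemma norm_spiral_inv_pow_le_one (hκ : 0 ≤ κ) (hθ : θ ∈ Set.Icc 0 (2 * Real.pi)) (n : ℕ) :
    ‖(spiral κ θ)⁻¹ ^ n‖ ≤ 1 := by
  rw [norm_pow, norm_inv]
  exact pow_le_one₀ (by positivity) (inv_le_one_of_one_le₀ (one_le_norm_spiral hκ hθ))

lemma chord_exp_add_mul_I (x : ℝ) (hθ : θ ∈ Set.Icc 0 (2 * Real.pi)) :
    chord (Complex.exp (x + θ * Complex.I)) = arcChord θ := by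
  rw [chord_exp, show ((x : ℂ) + θ * Complex.I).im = θ by simp]
  exact abs_of_nonneg (arcChord_nonneg hθ)

lemma chord_spiral (κ : ℝ) (hθ : θ ∈ Set.Icc 0 (2 * Real.pi)) :
    chord (spiral κ θ) = arcChord θ := by
  simpa only [spiral, Complex.ofReal_mul] using chord_exp_add_mul_I (κ * arcChord θ) hθ

lemma norm_spiral_eq_exp_chord (κ : ℝ) (hθ : θ ∈ Set.Icc 0 (2 * Real.pi)) :
    ‖spiral κ θ‖ = Real.exp (κ * chord (spiral κ θ)) := by
  rw [norm_spiral, chord_spiral κ hθ]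

lemma div_spiral_mem_spiralDomain (hκ : 0 < κ) {z : ℂ} (hz : z ∈ spiralClosure κ)
    (hθ : θ ∈ Set.Ioo 0 (2 * Real.pi)) : z / spiral (2 * κ) θ ∈ spiralDomain κ := by
  have hθ' := Set.Ioo_subset_Icc_self hθ
  exact div_mem_spiralDomain hκ (norm_spiral_eq_exp_chord _ hθ')
    (by rw [chord_spiral _ hθ']; exact arcChord_pos hθ) hz

lemma norm_one_sub_div_spiral_rpow_le (hκ : 0 < κ) (hκ1 : 4 * κ ≤ 1) (e : ℝ) :
    ∃ C : ℝ, 0 < C ∧ ∀ z ∈ spiralClosure κ, ∀ θ ∈ Set.Ioo 0 (2 * Real.pi),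
      ‖1 - z / spiral (2 * κ) θ‖ ^ e ≤ C * (‖1 - z‖ + arcChord θ) ^ e := by
  refine ⟨(15 / κ)⁻¹ ^ e + (15 / κ) ^ e, by positivity, fun z hz θ hθ => ?_⟩
  have hθ' := Set.Ioo_subset_Icc_self hθ
  have h := add_chord_comparable_norm_one_sub_div hκ hκ1 (norm_spiral_eq_exp_chord (2 * κ) hθ') hz
  rw [chord_spiral _ hθ'] at h
  exact rpow_le_of_comparable (by positivity)
    (add_pos_of_nonneg_of_pos (norm_nonneg _) (arcChord_pos hθ)) h.2 h.1 e

end spiral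

lemma isBigO_iteratedDeriv_of_closedBall_subset {g : ℂ → ℂ} {p : ℂ} {D D' : Set ℂ} {b δ : ℝ}
    (hg : DifferentiableOn ℂ g D) (hgO : g =O[𝓟 D] fun z => ‖p - z‖ ^ b) (hδ : 0 < δ)
    (hδ1 : δ < 1) (hp : p ∉ D') (hball : ∀ z ∈ D', Metric.closedBall z (δ * ‖p - z‖) ⊆ D) (j : ℕ) :
    iteratedDeriv j g =O[𝓟 D'] fun z => ‖p - z‖ ^ (b - j) := by
  obtain ⟨C, hC0, hC⟩ := hgO.exists_nonneg
  rw [isBigOWith_principal] at hC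
  set M := (1 - δ) ^ b + (1 + δ) ^ b
  refine isBigO_principal.2 ⟨j.factorial * (C * M) / δ ^ j, fun z hz => ?_⟩
  have hpz : 0 < ‖p - z‖ := norm_pos_iff.2 (sub_ne_zero.2 fun h => hp (h ▸ hz))
  have hR : 0 < δ * ‖p - z‖ := mul_pos hδ hpz
  have hdiff : DiffContOnCl ℂ g (Metric.ball z (δ * ‖p - z‖)) := by
    apply DifferentiableOn.diffContOnCl
    rw [closure_ball _ hR.ne']
    exact hg.mono (hball z hz)
  have hsphere : ∀ w ∈ Metric.sphere z (δ * ‖p - z‖), ‖g w‖ ≤ C * (M * ‖p - z‖ ^ b) := by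
    intro w hw
    have hwz : ‖w - z‖ = δ * ‖p - z‖ := mem_sphere_iff_norm.1 hw
    have hsub : p - w = (p - z) - (w - z) := by ring
    have hlow : (1 - δ) * ‖p - z‖ ≤ ‖p - w‖ := by
      have := norm_sub_norm_le (p - z) (w - z)
      rw [hsub]; linarith
    have hupp : ‖p - w‖ ≤ (1 + δ) * ‖p - z‖ := by
      have := norm_sub_le (p - z) (w - z)
      rw [hsub]; linarith
    have h := rpow_le_rpow_add_rpow (mul_pos (sub_pos.2 hδ1) hpz) hlow hupp b
    rw [Real.mul_rpow (sub_pos.2 hδ1).le hpz.le, Real.mul_rpow (by linarith) hpz.le,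
      ← add_mul] at h
    have hgw := hC w (hball z hz (Metric.sphere_subset_closedBall hw))
    rw [Real.norm_of_nonneg (by positivity)] at hgw
    exact hgw.trans (by gcongr)
  refine (Complex.norm_iteratedDeriv_le_of_forall_mem_sphere_norm_le j hR hdiff hsphere).trans_eq ?_
  rw [Real.norm_of_nonneg (by positivity), Real.rpow_sub hpz, Real.rpow_natCast, mul_pow]
  field_simp

lemma integral_eq_integral_of_hasDerivAt {A B F : ℝ → ℝ → ℂ} {s t a b : ℝ}
    (hF : ContinuousOn F.uncurry (Set.uIcc s t ×ˢ Set.uIcc a b))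
    (hA : ∀ x ∈ Set.uIcc s t, ∀ θ ∈ Set.uIcc a b, HasDerivAt (fun x => A x θ) (F x θ) x)
    (hB : ∀ x ∈ Set.uIcc s t, ∀ θ ∈ Set.uIcc a b, HasDerivAt (B x) (F x θ) θ)
    (hends : ∀ x ∈ Set.uIcc s t, B x a = B x b)
    (hAs : IntervalIntegrable (A s) volume a b) (hAt : IntervalIntegrable (A t) volume a b) :
    ∫ θ in a..b, A t θ = ∫ θ in a..b, A s θ := by
  have hAint : ∀ θ ∈ Set.uIcc a b, A t θ - A s θ = ∫ x in s..t, F x θ := fun θ hθ =>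
    (intervalIntegral.integral_eq_sub_of_hasDerivAt (fun x hx => hA x hx θ hθ)
      (hF.uncurry_right θ hθ).intervalIntegrable).symm
  have hBint : ∀ x ∈ Set.uIcc s t, ∫ θ in a..b, F x θ = 0 := fun x hx => by
    rw [intervalIntegral.integral_eq_sub_of_hasDerivAt (hB x hx)
      (hF.uncurry_left x hx).intervalIntegrable, hends x hx, sub_self]
  rw [← sub_eq_zero, ← intervalIntegral.integral_sub hAt hAs,
    intervalIntegral.integral_congr hAint, ← intervalIntegral_intervalIntegral_swap,
    intervalIntegral.integral_congr hBint, intervalIntegral.integral_zero]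
  exact (hF.integrableOn_compact (isCompact_uIcc.prod isCompact_uIcc)).mono_set
    (Set.prod_mono Set.uIoc_subset_uIcc Set.uIoc_subset_uIcc)

lemma hasDerivAt_comp_mul {Φ : ℂ → ℂ} {c u : ℝ → ℂ} {c' u' : ℂ} {x : ℝ}
    (hΦ : AnalyticAt ℂ Φ (c x)) (hc : HasDerivAt c c' x) (hu : HasDerivAt u u' x) :
    HasDerivAt (fun y => Φ (c y) * u y) (deriv Φ (c x) * c' * u x + Φ (c x) * u') x :=
  (hΦ.differentiableAt.hasDerivAt.comp x hc).mul hu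

lemma integral_comp_add_mul_deriv_eq {Φ : ℂ → ℂ} {p p' q q' : ℝ → ℂ} {a b : ℝ}
    (hp : ∀ θ, HasDerivAt p (p' θ) θ) (hq : ∀ θ, HasDerivAt q (q' θ) θ) (hp' : Continuous p')
    (hq' : Continuous q') (hqa : q a = 0) (hqb : q b = 0)
    (hΦ : ∀ t ∈ Set.uIcc (0 : ℝ) 1, ∀ θ ∈ Set.uIcc a b, AnalyticAt ℂ Φ (p θ + t * q θ)) :
    ∫ θ in a..b, Φ (p θ + q θ) * (p' θ + q' θ) = ∫ θ in a..b, Φ (p θ) * p' θ := by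
  have hpc : Continuous p := continuous_iff_continuousAt.2 fun θ => (hp θ).continuousAt
  have hqc : Continuous q := continuous_iff_continuousAt.2 fun θ => (hq θ).continuousAt
  have hcomp : ∀ Ψ : ℂ → ℂ, (∀ t ∈ Set.uIcc (0 : ℝ) 1, ∀ θ ∈ Set.uIcc a b,
      ContinuousAt Ψ (p θ + t * q θ)) → ContinuousOn (fun x : ℝ × ℝ => Ψ (p x.2 + x.1 * q x.2))
        (Set.uIcc (0 : ℝ) 1 ×ˢ Set.uIcc a b) := fun Ψ hΨ x hx =>
    (ContinuousAt.comp (x := x) (g := Ψ) (f := fun x : ℝ × ℝ => p x.2 + x.1 * q x.2)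
      (hΨ x.1 hx.1 x.2 hx.2) (by fun_prop)).continuousWithinAt
  have hΦc := hcomp Φ fun t ht θ hθ => (hΦ t ht θ hθ).continuousAt
  have hdΦc := hcomp (deriv Φ) fun t ht θ hθ => (hΦ t ht θ hθ).deriv.continuousAt
  have hlin : ∀ (u v : ℂ) (t : ℝ), HasDerivAt (fun t : ℝ => u + t * v) v t := fun u v t => by
    simpa using ((hasDerivAt_id t).ofReal_comp.mul_const v).const_add u
  have hint : ∀ t ∈ Set.uIcc (0 : ℝ) 1, IntervalIntegrable
      (fun θ => Φ (p θ + t * q θ) * (p' θ + t * q' θ)) volume a b := fun t ht =>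
    ((hΦc.comp (f := fun θ => (t, θ)) (by fun_prop) fun θ hθ => ⟨ht, hθ⟩).mul
      (g := fun θ => p' θ + t * q' θ) (by fun_prop)).intervalIntegrable
  have key := integral_eq_integral_of_hasDerivAt
    (A := fun t θ => Φ (p θ + t * q θ) * (p' θ + t * q' θ))
    (B := fun t θ => Φ (p θ + t * q θ) * q θ)
    (F := fun t θ => deriv Φ (p θ + t * q θ) * q θ * (p' θ + t * q' θ) + Φ (p θ + t * q θ) * q' θ)
    (((hdΦc.mul (by fun_prop)).mul (by fun_prop)).add (hΦc.mul (by fun_prop)))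
    (fun t ht θ hθ => hasDerivAt_comp_mul (hΦ t ht θ hθ) (hlin _ _ t) (hlin _ _ t))
    (fun t ht θ hθ => (hasDerivAt_comp_mul (c := fun θ => p θ + t * q θ) (hΦ t ht θ hθ)
      ((hp θ).fun_add ((hq θ).const_mul (t : ℂ))) (hq θ)).congr_deriv (by ring))
    (fun t _ => by simp only [hqa, hqb, mul_zero])
    (hint 0 Set.left_mem_uIcc) (hint 1 Set.right_mem_uIcc)
  simpa using key

section kernel

variable {α p ρ : ℝ}

lemma arcChord_two_pi_sub (θ : ℝ) : arcChord (2 * Real.pi - θ) = arcChord θ := by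
  rw [arcChord, sub_div, mul_div_cancel_left₀ _ two_ne_zero, Real.sin_pi_sub, arcChord]

lemma arcChord_le_two (θ : ℝ) : arcChord θ ≤ 2 := by
  unfold arcChord
  linarith [Real.sin_le_one (θ / 2)]

lemma arcChord_le_self {θ : ℝ} (hθ : 0 ≤ θ) : arcChord θ ≤ θ := by
  unfold arcChord
  linarith [Real.sin_le (by positivity : 0 ≤ θ / 2)]

lemma le_two_mul_arcChord {θ : ℝ} (hθ : 0 ≤ θ) (hθπ : θ ≤ Real.pi) : θ ≤ 2 * arcChord θ := by
  have h := Real.mul_le_sin (x := θ / 2) (by linarith) (by linarith)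
  have h2 : 1 / 2 ≤ 2 / Real.pi := by
    rw [div_le_div_iff₀ two_pos Real.pi_pos]
    linarith [Real.pi_le_four]
  have := mul_le_mul_of_nonneg_right h2 (by linarith : 0 ≤ θ / 2)
  unfold arcChord
  linarith

lemma intervalIntegrable_comp_arcChord {F : ℝ → ℝ}
    (hF : IntervalIntegrable (fun θ => F (arcChord θ)) volume 0 Real.pi) :
    IntervalIntegrable (fun θ => F (arcChord θ)) volume Real.pi (2 * Real.pi) := by
  have h := hF.comp_sub_left (2 * Real.pi)
  simp only [arcChord_two_pi_sub, sub_zero] at h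
  rw [show 2 * Real.pi - Real.pi = Real.pi by ring] at h
  exact h.symm

lemma integrableOn_comp_arcChord {F : ℝ → ℝ}
    (hF : IntervalIntegrable (fun θ => F (arcChord θ)) volume 0 Real.pi) :
    IntegrableOn (fun θ => F (arcChord θ)) (Set.Ioo 0 (2 * Real.pi)) :=
  (intervalIntegrable_iff_integrableOn_Ioo_of_le Real.two_pi_pos.le).1
    (hF.trans (intervalIntegrable_comp_arcChord hF))

lemma integral_comp_arcChord {F : ℝ → ℝ}
    (hF : IntervalIntegrable (fun θ => F (arcChord θ)) volume 0 Real.pi) :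
    ∫ θ in Set.Ioo 0 (2 * Real.pi), F (arcChord θ) = 2 * ∫ θ in 0..Real.pi, F (arcChord θ) := by
  have h := intervalIntegral.integral_comp_sub_left (a := Real.pi) (b := 2 * Real.pi)
    (fun θ => F (arcChord θ)) (2 * Real.pi)
  simp only [arcChord_two_pi_sub, sub_self] at h
  rw [show 2 * Real.pi - Real.pi = Real.pi by ring] at h
  rw [← integral_Ioc_eq_integral_Ioo, ← intervalIntegral.integral_of_le Real.two_pi_pos.le,
    ← intervalIntegral.integral_add_adjacent_intervals hF (intervalIntegrable_comp_arcChord hF), h,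
    two_mul]

lemma continuousOn_rpow_mul_add_rpow (α p : ℝ) (hρ : 0 ≤ ρ) :
    ContinuousOn (fun s : ℝ => s ^ α * (ρ + s) ^ p) (Set.Ioi 0) := fun s (hs : 0 < s) =>
  ((Real.continuousAt_rpow_const s α (Or.inl hs.ne')).mul
    (ContinuousAt.rpow_const (by fun_prop) (Or.inl (by positivity)))).continuousWithinAt

lemma intervalIntegrable_rpow_mul_add_rpow (hα : -1 < α) (hρ : 0 < ρ) {x y : ℝ} (hx : 0 ≤ x)
    (hy : 0 ≤ y) : IntervalIntegrable (fun s : ℝ => s ^ α * (ρ + s) ^ p) volume x y := by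
  refine (intervalIntegral.intervalIntegrable_rpow' hα).mul_continuousOn fun s hs => ?_
  have : 0 ≤ s := (le_min hx hy).trans hs.1
  exact (ContinuousAt.rpow_const (by fun_prop) (Or.inl (by positivity))).continuousWithinAt

lemma arcChord_rpow_mul_add_rpow_le (α p : ℝ) : ∃ C : ℝ, 0 < C ∧ ∀ ρ : ℝ, 0 ≤ ρ →
    ∀ θ ∈ Set.Ioc 0 Real.pi,
      arcChord θ ^ α * (ρ + arcChord θ) ^ p ≤ C * (θ ^ α * (ρ + θ) ^ p) := by
  refine ⟨(2⁻¹ ^ α + 2 ^ α) * (2⁻¹ ^ p + 2 ^ p), by positivity, fun ρ hρ θ hθ => ?_⟩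
  have hle := arcChord_le_self hθ.1.le
  have hge := le_two_mul_arcChord hθ.1.le hθ.2
  have hpos : 0 < arcChord θ := arcChord_pos ⟨hθ.1, by linarith [hθ.2, Real.pi_pos]⟩
  rw [mul_mul_mul_comm]
  exact mul_le_mul
    (rpow_le_of_comparable two_pos hθ.1 (by linarith [hθ.1]) hge α)
    (rpow_le_of_comparable two_pos (by linarith [hθ.1]) (by linarith [hθ.1]) (by linarith) p)
    (by positivity) (mul_nonneg (by positivity) (Real.rpow_nonneg hθ.1.le _))

lemma intervalIntegrable_arcChord_rpow_mul_add_rpow (hα : -1 < α) (hρ : 0 < ρ) :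
    IntervalIntegrable (fun θ => arcChord θ ^ α * (ρ + arcChord θ) ^ p) volume 0 Real.pi := by
  obtain ⟨C, -, hC⟩ := arcChord_rpow_mul_add_rpow_le α p
  have hint :=
    (intervalIntegrable_rpow_mul_add_rpow (p := p) hα hρ le_rfl Real.pi_pos.le).const_mul C
  have hpos : ∀ θ ∈ Set.Ioc 0 Real.pi, 0 < arcChord θ := fun θ hθ =>
    arcChord_pos ⟨hθ.1, by linarith [hθ.2, Real.pi_pos]⟩
  rw [intervalIntegrable_iff_integrableOn_Ioc_of_le Real.pi_pos.le] at hint ⊢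
  refine hint.mono' (ContinuousOn.aestronglyMeasurable ?_ measurableSet_Ioc)
    (ae_restrict_of_forall_mem measurableSet_Ioc fun θ hθ => ?_)
  · exact (continuousOn_rpow_mul_add_rpow α p hρ.le).comp continuous_arcChord.continuousOn hpos
  · have := hpos θ hθ
    rw [Real.norm_of_nonneg (by positivity)]
    exact hC ρ hρ.le θ hθ

lemma integrableOn_arcChord_rpow_mul_add_rpow (p : ℝ) (hα : -1 < α) (hρ : 0 < ρ) :
    IntegrableOn (fun θ => arcChord θ ^ α * (ρ + arcChord θ) ^ p) (Set.Ioo 0 (2 * Real.pi)) :=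
  integrableOn_comp_arcChord (F := fun s => s ^ α * (ρ + s) ^ p)
    (intervalIntegrable_arcChord_rpow_mul_add_rpow hα hρ)

lemma integrableOn_arcChord_rpow (hα : -1 < α) :
    IntegrableOn (fun θ => arcChord θ ^ α) (Set.Ioo 0 (2 * Real.pi)) := by
  simpa using integrableOn_arcChord_rpow_mul_add_rpow 0 hα one_pos

lemma integral_rpow_mul_add_rpow_le {T : ℝ} (hα : -1 < α) (hp : p ≤ 0) (hρ : 0 < ρ)
    (hρT : ρ ≤ T) : ∫ s in 0..T, s ^ α * (ρ + s) ^ p ≤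
      ρ ^ (α + p + 1) / (α + 1) + ∫ s in ρ..T, s ^ (α + p) := by
  have hint : ∀ {x y : ℝ}, 0 ≤ x → 0 ≤ y →
      IntervalIntegrable (fun s : ℝ => s ^ α * (ρ + s) ^ p) volume x y :=
    intervalIntegrable_rpow_mul_add_rpow hα hρ
  have hnear : ∫ s in 0..ρ, s ^ α * (ρ + s) ^ p ≤ ρ ^ (α + p + 1) / (α + 1) := by
    calc ∫ s in 0..ρ, s ^ α * (ρ + s) ^ p ≤ ∫ s in 0..ρ, s ^ α * ρ ^ p := by
          refine intervalIntegral.integral_mono_on hρ.le (hint le_rfl hρ.le)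
            ((intervalIntegral.intervalIntegrable_rpow' hα).mul_const _) fun s hs => ?_
          have := hs.1
          gcongr ?_ * ?_
          exact Real.rpow_le_rpow_of_nonpos hρ (by linarith) hp
      _ = ρ ^ (α + p + 1) / (α + 1) := by
          rw [intervalIntegral.integral_mul_const, integral_rpow (Or.inl hα),
            Real.zero_rpow (by linarith), sub_zero, div_mul_eq_mul_div, ← Real.rpow_add hρ,
            add_right_comm]
  have hfar : ∫ s in ρ..T, s ^ α * (ρ + s) ^ p ≤ ∫ s in ρ..T, s ^ (α + p) := by
    refine intervalIntegral.integral_mono_on hρT (hint hρ.le (hρ.le.trans hρT))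
      (intervalIntegral.intervalIntegrable_rpow (Or.inr ?_)) fun s hs => ?_
    · exact fun h => hρ.not_ge (by simpa [hρT] using h.1)
    · have hs0 : 0 < s := hρ.trans_le hs.1
      rw [Real.rpow_add hs0]
      gcongr ?_ * ?_
      exact Real.rpow_le_rpow_of_nonpos hs0 (by linarith) hp
  rw [← intervalIntegral.integral_add_adjacent_intervals (hint le_rfl hρ.le)
    (hint hρ.le (hρ.le.trans hρT))]
  exact add_le_add hnear hfar

lemma integral_arcChord_rpow_mul_add_rpow_le (hα : -1 < α) (hp : p ≤ 0) : ∃ C : ℝ, 0 < C ∧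
    ∀ ρ : ℝ, 0 < ρ → ρ ≤ Real.pi →
      ∫ θ in Set.Ioo 0 (2 * Real.pi), arcChord θ ^ α * (ρ + arcChord θ) ^ p ≤
        C * (ρ ^ (α + p + 1) + ∫ s in ρ..Real.pi, s ^ (α + p)) := by
  obtain ⟨C, hC0, hC⟩ := arcChord_rpow_mul_add_rpow_le α p
  have hα1 : 0 < α + 1 := by linarith
  refine ⟨2 * C * ((α + 1)⁻¹ + 1), by positivity, fun ρ hρ hρπ => ?_⟩
  have hint := intervalIntegrable_arcChord_rpow_mul_add_rpow (p := p) hα hρ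
  have hle : ∫ θ in 0..Real.pi, arcChord θ ^ α * (ρ + arcChord θ) ^ p ≤
      C * ∫ θ in 0..Real.pi, θ ^ α * (ρ + θ) ^ p := by
    rw [← intervalIntegral.integral_const_mul]
    exact intervalIntegral.integral_mono_on_of_le_Ioo Real.pi_pos.le hint
      ((intervalIntegrable_rpow_mul_add_rpow hα hρ le_rfl Real.pi_pos.le).const_mul C)
      fun θ hθ => hC ρ hρ.le θ (Set.Ioo_subset_Ioc_self hθ)
  have hsplit := integral_rpow_mul_add_rpow_le hα hp hρ hρπ
  have htail : 0 ≤ ∫ s in ρ..Real.pi, s ^ (α + p) :=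
    intervalIntegral.integral_nonneg hρπ fun s hs => Real.rpow_nonneg (hρ.le.trans hs.1) _
  rw [integral_comp_arcChord (F := fun s => s ^ α * (ρ + s) ^ p) hint]
  calc 2 * ∫ θ in 0..Real.pi, arcChord θ ^ α * (ρ + arcChord θ) ^ p
      ≤ 2 * (C * (ρ ^ (α + p + 1) / (α + 1) + ∫ s in ρ..Real.pi, s ^ (α + p))) := by
        gcongr; exact hle.trans (by gcongr)
    _ ≤ 2 * C * ((α + 1)⁻¹ + 1) * (ρ ^ (α + p + 1) + ∫ s in ρ..Real.pi, s ^ (α + p)) := by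
        rw [div_eq_inv_mul, ← mul_assoc, mul_assoc (2 * C)]
        gcongr
        have := Real.rpow_nonneg hρ.le (α + p + 1)
        nlinarith [mul_nonneg (inv_nonneg.2 hα1.le) htail]

lemma integral_arcChord_le_rpow (hα : -1 < α) (hneg : α + p + 1 < 0) :
    ∃ C : ℝ, ∀ ρ : ℝ, 0 < ρ → ρ ≤ Real.pi →
      ∫ θ in Set.Ioo 0 (2 * Real.pi), arcChord θ ^ α * (ρ + arcChord θ) ^ p ≤
        C * ρ ^ (α + p + 1) := by
  obtain ⟨C, hC0, hC⟩ := integral_arcChord_rpow_mul_add_rpow_le hα (by linarith : p ≤ 0)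
  have hpos : 0 < -(α + p + 1) := by linarith
  refine ⟨C * (1 + (-(α + p + 1))⁻¹), fun ρ hρ hρπ => (hC ρ hρ hρπ).trans ?_⟩
  have htail : ∫ s in ρ..Real.pi, s ^ (α + p) ≤ (-(α + p + 1))⁻¹ * ρ ^ (α + p + 1) := by
    rw [integral_rpow (Or.inr ⟨by linarith, fun h => hρ.not_ge (by simpa [hρπ] using h.1)⟩),
      ← neg_div_neg_eq, neg_sub, div_eq_inv_mul]
    gcongr
    exact sub_le_self _ (Real.rpow_nonneg Real.pi_pos.le _)
  calc _ ≤ C * (ρ ^ (α + p + 1) + (-(α + p + 1))⁻¹ * ρ ^ (α + p + 1)) := by gcongr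
    _ = _ := by ring

lemma integral_arcChord_le_log (hα : -1 < α) (hzero : α + p + 1 = 0) :
    ∃ C : ℝ, ∀ ρ : ℝ, 0 < ρ → ρ ≤ Real.pi →
      ∫ θ in Set.Ioo 0 (2 * Real.pi), arcChord θ ^ α * (ρ + arcChord θ) ^ p ≤
        C * (1 + |Real.log ρ|) := by
  obtain ⟨C, hC0, hC⟩ := integral_arcChord_rpow_mul_add_rpow_le hα (by linarith : p ≤ 0)
  have hlogπ : 0 ≤ Real.log Real.pi := Real.log_nonneg (by linarith [Real.pi_gt_three])
  refine ⟨C * (1 + Real.log Real.pi), fun ρ hρ hρπ => (hC ρ hρ hρπ).trans ?_⟩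
  have hαp : α + p = -1 := by linarith
  have htail : ∫ s in ρ..Real.pi, s ^ (α + p) = Real.log Real.pi - Real.log ρ := by
    simp only [hαp, Real.rpow_neg_one]
    rw [integral_inv_of_pos hρ Real.pi_pos, Real.log_div Real.pi_pos.ne' hρ.ne']
  rw [htail, hzero, Real.rpow_zero, mul_assoc]
  gcongr
  nlinarith [neg_abs_le (Real.log ρ), mul_nonneg hlogπ (abs_nonneg (Real.log ρ))]

end kernel

/-! ### Integrals along the spiral -/

/-- The integrand of `spiralIntegral`; it is the `j`-th derivative in `z` of the integrand for
`j = 0`. -/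
noncomputable def spiralIntegrand (κ : ℝ) (k : ℝ → ℂ) (g : ℂ → ℂ) (j : ℕ) (z : ℂ) (θ : ℝ) : ℂ :=
  k θ * (spiral (2 * κ) θ)⁻¹ ^ j * iteratedDeriv j g (z / spiral (2 * κ) θ)

/-- The integral `∫ k(θ) w⁻ʲ g⁽ʲ⁾(z / w) dθ` along the spiral `w = w(θ)`. With Cauchy's weight
`k(θ) = f(w) w'(θ) / (2πi w)` and `j = 0` this represents the Hadamard product of `f` and `g`. -/
noncomputable def spiralIntegral (κ : ℝ) (k : ℝ → ℂ) (g : ℂ → ℂ) (j : ℕ) (z : ℂ) : ℂ :=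
  ∫ θ in Set.Ioo 0 (2 * Real.pi), spiralIntegrand κ k g j z θ

/-- A weight `k` and a function `g` whose spiral integral has a singularity of order
`α + β + 1` at `1`. The bounds on the derivatives of `g` are required on the domain that contains
the quotients `z / w`, where they come from Cauchy's estimates on a larger domain. -/
structure SpiralData (κ α β : ℝ) (k : ℝ → ℂ) (g : ℂ → ℂ) : Prop where
  pos : 0 < κ
  four_mul_le_one : 4 * κ ≤ 1
  neg_one_lt : -1 < α
  continuousOn : ContinuousOn k (Set.Ioo 0 (2 * Real.pi))
  isBigO_weight : k =O[𝓟 (Set.Ioo 0 (2 * Real.pi))] fun θ => arcChord θ ^ α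
  analytic : AnalyticOnNhd ℂ g (spiralDomain κ)
  isBigO_iteratedDeriv (j : ℕ) :
    iteratedDeriv j g =O[𝓟 (spiralDomain κ)] fun z : ℂ => ‖1 - z‖ ^ (β - j)

namespace SpiralData

variable {κ α β : ℝ} {k : ℝ → ℂ} {g : ℂ → ℂ}

lemma norm_spiralIntegrand_le (H : SpiralData κ α β k g) (j : ℕ) :
    ∃ C : ℝ, 0 < C ∧ ∀ z ∈ spiralClosure κ, ∀ θ ∈ Set.Ioo 0 (2 * Real.pi),
      ‖spiralIntegrand κ k g j z θ‖ ≤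
        C * (arcChord θ ^ α * (‖1 - z‖ + arcChord θ) ^ (β - j)) := by
  obtain ⟨A, hA, hk⟩ := H.isBigO_weight.exists_pos
  obtain ⟨B, hB, hg⟩ := (H.isBigO_iteratedDeriv j).exists_pos
  obtain ⟨K, hK, hcomp⟩ := norm_one_sub_div_spiral_rpow_le H.pos H.four_mul_le_one (β - j)
  rw [isBigOWith_principal] at hk hg
  refine ⟨A * (B * K), by positivity, fun z hz θ hθ => ?_⟩
  have hs := arcChord_pos hθ
  have hkθ := hk θ hθ
  have hgθ := hg _ (div_spiral_mem_spiralDomain H.pos hz hθ)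
  rw [Real.norm_of_nonneg (by positivity)] at hkθ hgθ
  have hinv := norm_spiral_inv_pow_le_one (κ := 2 * κ) (by linarith [H.pos])
    (Set.Ioo_subset_Icc_self hθ) j
  rw [spiralIntegrand, norm_mul, norm_mul]
  calc _ ≤ (A * arcChord θ ^ α) * 1 * (B * (K * (‖1 - z‖ + arcChord θ) ^ (β - j))) := by
        gcongr
        exact hgθ.trans (by gcongr; exact hcomp z hz θ hθ)
    _ = _ := by ring

lemma analyticOnNhd_iteratedDeriv (H : SpiralData κ α β k g) (j : ℕ) :
    AnalyticOnNhd ℂ (iteratedDeriv j g) (spiralDomain κ) := by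
  rw [iteratedDeriv_eq_iterate]
  exact H.analytic.iterated_deriv j

lemma continuousOn_spiralIntegrand (H : SpiralData κ α β k g) (j : ℕ) {z : ℂ}
    (hz : z ∈ spiralClosure κ) :
    ContinuousOn (spiralIntegrand κ k g j z) (Set.Ioo 0 (2 * Real.pi)) := by
  have hw : ContinuousOn (spiral (2 * κ)) (Set.Ioo 0 (2 * Real.pi)) :=
    (continuous_spiral _).continuousOn
  refine (H.continuousOn.mul ((hw.inv₀ fun θ _ => spiral_ne_zero _ θ).pow j)).mul ?_
  exact (H.analyticOnNhd_iteratedDeriv j).continuousOn.comp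
    (continuousOn_const.div hw fun θ _ => spiral_ne_zero _ θ)
    fun θ hθ => div_spiral_mem_spiralDomain H.pos hz hθ

lemma aestronglyMeasurable_spiralIntegrand (H : SpiralData κ α β k g) (j : ℕ) {z : ℂ}
    (hz : z ∈ spiralClosure κ) :
    AEStronglyMeasurable (spiralIntegrand κ k g j z)
      (volume.restrict (Set.Ioo 0 (2 * Real.pi))) :=
  (H.continuousOn_spiralIntegrand j hz).aestronglyMeasurable measurableSet_Ioo

lemma hasDerivAt_spiralIntegrand (H : SpiralData κ α β k g) (j : ℕ) {z : ℂ}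
    (hz : z ∈ spiralClosure κ) {θ : ℝ} (hθ : θ ∈ Set.Ioo 0 (2 * Real.pi)) :
    HasDerivAt (fun x => spiralIntegrand κ k g j x θ) (spiralIntegrand κ k g (j + 1) z θ) z := by
  have hg : HasDerivAt (iteratedDeriv j g) (iteratedDeriv (j + 1) g (z / spiral (2 * κ) θ))
      (z / spiral (2 * κ) θ) := by
    rw [iteratedDeriv_succ]
    exact (H.analyticOnNhd_iteratedDeriv j _
      (div_spiral_mem_spiralDomain H.pos hz hθ)).differentiableAt.hasDerivAt
  refine ((hg.comp z ((hasDerivAt_id z).div_const (spiral (2 * κ) θ))).const_mul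
    (k θ * (spiral (2 * κ) θ)⁻¹ ^ j)).congr_deriv ?_
  rw [spiralIntegrand]
  ring

lemma integrableOn_spiralIntegrand (H : SpiralData κ α β k g) (j : ℕ) {z : ℂ}
    (hz : z ∈ spiralClosure κ) (hz1 : z ≠ 1) :
    IntegrableOn (spiralIntegrand κ k g j z) (Set.Ioo 0 (2 * Real.pi)) := by
  obtain ⟨C, -, hC⟩ := H.norm_spiralIntegrand_le j
  refine Integrable.mono' ((integrableOn_arcChord_rpow_mul_add_rpow (β - j) H.neg_one_lt
    (norm_pos_iff.2 (sub_ne_zero.2 hz1.symm))).const_mul C)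
    (H.aestronglyMeasurable_spiralIntegrand j hz) ?_
  exact ae_restrict_of_forall_mem measurableSet_Ioo (hC z hz)

lemma norm_spiralIntegral_le (H : SpiralData κ α β k g) (j : ℕ) :
    ∃ C : ℝ, 0 < C ∧ ∀ z ∈ spiralClosure κ, z ≠ 1 →
      ‖spiralIntegral κ k g j z‖ ≤ C * ∫ θ in Set.Ioo 0 (2 * Real.pi),
        arcChord θ ^ α * (‖1 - z‖ + arcChord θ) ^ (β - j) := by
  obtain ⟨C, hC0, hC⟩ := H.norm_spiralIntegrand_le j
  refine ⟨C, hC0, fun z hz hz1 => ?_⟩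
  rw [← integral_const_mul]
  exact norm_integral_le_of_norm_le ((integrableOn_arcChord_rpow_mul_add_rpow (β - j)
    H.neg_one_lt (norm_pos_iff.2 (sub_ne_zero.2 hz1.symm))).const_mul C)
    (ae_restrict_of_forall_mem measurableSet_Ioo (hC z hz))

variable {D : Set ℂ}

lemma hasDerivAt_spiralIntegral (H : SpiralData κ α β k g) (hD : IsOpen D)
    (hDκ : D ⊆ spiralClosure κ) (h1 : (1 : ℂ) ∉ D) (j : ℕ) {z : ℂ} (hz : z ∈ D) :
    HasDerivAt (spiralIntegral κ k g j) (spiralIntegral κ k g (j + 1) z) z := by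
  obtain ⟨C, hC0, hC⟩ := H.norm_spiralIntegrand_le (j + 1)
  have hz1 : z ≠ 1 := ne_of_mem_of_not_mem hz h1
  set ρ := ‖1 - z‖
  have hρ0 : 0 < ρ := norm_pos_iff.2 (sub_ne_zero.2 hz1.symm)
  set e : ℝ := β - (j + 1 : ℕ)
  have hdist : ∀ x ∈ Metric.ball z (ρ / 2), ρ / 2 ≤ ‖1 - x‖ ∧ ‖1 - x‖ ≤ 3 * ρ / 2 := by
    intro x hx
    rw [mem_ball_iff_norm] at hx
    have hle := norm_sub_le_norm_sub_add_norm_sub 1 x z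
    have hge := norm_sub_le_norm_sub_add_norm_sub 1 z x
    rw [norm_sub_rev z x] at hge
    constructor <;> linarith
  have hbound : ∀ θ ∈ Set.Ioo 0 (2 * Real.pi), ∀ x ∈ D ∩ Metric.ball z (ρ / 2),
      ‖spiralIntegrand κ k g (j + 1) x θ‖ ≤
        C * ((ρ / 2) ^ e + (3 * ρ / 2 + 2) ^ e) * arcChord θ ^ α := by
    intro θ hθ x hx
    obtain ⟨hlow, hupp⟩ := hdist x hx.2
    have hs := arcChord_pos hθ
    have hs2 := arcChord_le_two θ
    calc _ ≤ C * (arcChord θ ^ α * (‖1 - x‖ + arcChord θ) ^ e) := hC x (hDκ hx.1) θ hθ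
      _ ≤ C * (arcChord θ ^ α * ((ρ / 2) ^ e + (3 * ρ / 2 + 2) ^ e)) := by
        gcongr
        exact rpow_le_rpow_add_rpow (by positivity) (by linarith) (by linarith) e
      _ = _ := by ring
  refine (hasDerivAt_integral_of_dominated_loc_of_deriv_le
    (F' := fun x θ => spiralIntegrand κ k g (j + 1) x θ)
    (inter_mem (hD.mem_nhds hz) (Metric.ball_mem_nhds z (half_pos hρ0)))
    ?_ (H.integrableOn_spiralIntegrand j (hDκ hz) hz1)
    (H.aestronglyMeasurable_spiralIntegrand (j + 1) (hDκ hz))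
    (ae_restrict_of_forall_mem measurableSet_Ioo hbound)
    ((integrableOn_arcChord_rpow H.neg_one_lt).const_mul _)
    (ae_restrict_of_forall_mem measurableSet_Ioo fun θ hθ x hx =>
      H.hasDerivAt_spiralIntegrand j (hDκ hx.1) hθ)).2
  filter_upwards [hD.mem_nhds hz] with x hx
  exact H.aestronglyMeasurable_spiralIntegrand j (hDκ hx)

lemma analyticOnNhd_spiralIntegral (H : SpiralData κ α β k g) (hD : IsOpen D)
    (hDκ : D ⊆ spiralClosure κ) (h1 : (1 : ℂ) ∉ D) :
    AnalyticOnNhd ℂ (spiralIntegral κ k g 0) D :=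
  DifferentiableOn.analyticOnNhd
    (fun _ hz => (H.hasDerivAt_spiralIntegral hD hDκ h1 0
      hz).differentiableAt.differentiableWithinAt) hD

lemma iteratedDeriv_spiralIntegral (H : SpiralData κ α β k g) (hD : IsOpen D)
    (hDκ : D ⊆ spiralClosure κ) (h1 : (1 : ℂ) ∉ D) (j : ℕ) :
    Set.EqOn (iteratedDeriv j (spiralIntegral κ k g 0)) (spiralIntegral κ k g j) D := by
  induction j with
  | zero => exact fun z _ => by rw [iteratedDeriv_zero]
  | succ j ih =>
    intro z hz
    rw [iteratedDeriv_succ, (ih.eventuallyEq_of_mem (hD.mem_nhds hz)).deriv_eq]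
    exact (H.hasDerivAt_spiralIntegral hD hDκ h1 j hz).deriv

lemma tendsto_spiralIntegral (H : SpiralData κ α β k g) (hDκ : D ⊆ spiralClosure κ) {j : ℕ}
    (hj : (j : ℝ) < α + β + 1) :
    Tendsto (spiralIntegral κ k g j) (𝓝[D] 1) (𝓝 (spiralIntegral κ k g j 1)) := by
  obtain ⟨C, hC0, hC⟩ := H.norm_spiralIntegrand_le j
  refine tendsto_integral_filter_of_dominated_convergence
    (fun θ => C * (arcChord θ ^ (α + (β - j)) + 3 ^ (β - j) * arcChord θ ^ α)) ?_ ?_ ?_ ?_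
  · filter_upwards [self_mem_nhdsWithin] with z hz
    exact H.aestronglyMeasurable_spiralIntegrand j (hDκ hz)
  · filter_upwards [self_mem_nhdsWithin,
      mem_nhdsWithin_of_mem_nhds (Metric.ball_mem_nhds (1 : ℂ) one_pos)] with z hz hz1
    rw [mem_ball_iff_norm'] at hz1
    refine ae_restrict_of_forall_mem measurableSet_Ioo fun θ hθ => ?_
    have hs := arcChord_pos hθ
    have hs2 := arcChord_le_two θ
    have hn := norm_nonneg (1 - z)
    calc _ ≤ C * (arcChord θ ^ α * (‖1 - z‖ + arcChord θ) ^ (β - j)) := hC z (hDκ hz) θ hθ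
      _ ≤ C * (arcChord θ ^ α * (arcChord θ ^ (β - j) + 3 ^ (β - j))) := by
        gcongr
        exact rpow_le_rpow_add_rpow hs (by linarith) (by linarith) _
      _ = _ := by rw [Real.rpow_add hs]; ring
  · exact ((integrableOn_arcChord_rpow (by linarith)).add
      ((integrableOn_arcChord_rpow H.neg_one_lt).const_mul _)).const_mul _
  · refine ae_restrict_of_forall_mem measurableSet_Ioo fun θ hθ => ?_
    exact (H.hasDerivAt_spiralIntegrand j (one_mem_spiralClosure κ)
      hθ).continuousAt.tendsto.mono_left nhdsWithin_le_nhds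

lemma hasDerivValueAtOne_spiralIntegral (H : SpiralData κ α β k g) (hD : IsOpen D)
    (hDκ : D ⊆ spiralClosure κ) (h1 : (1 : ℂ) ∉ D) {j : ℕ} (hj : (j : ℝ) < α + β + 1) :
    HasDerivValueAtOne (spiralIntegral κ k g 0) D j (spiralIntegral κ k g j 1) :=
  (H.tendsto_spiralIntegral hDκ hj).congr'
    ((H.iteratedDeriv_spiralIntegral hD hDκ h1 j).symm.eventuallyEq_of_mem self_mem_nhdsWithin)

variable (hDπ : ∀ z ∈ D, ‖1 - z‖ ≤ Real.pi)
include hDπ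

lemma isBigO_iteratedDeriv_spiralIntegral (H : SpiralData κ α β k g) (hD : IsOpen D)
    (hDκ : D ⊆ spiralClosure κ) (h1 : (1 : ℂ) ∉ D) {j : ℕ} (hj : α + β + 1 < j) :
    iteratedDeriv j (spiralIntegral κ k g 0)
      =O[𝓟 D] fun z => ‖1 - z‖ ^ (α + β + 1 - j) := by
  obtain ⟨C, hC0, hC⟩ := H.norm_spiralIntegral_le j
  obtain ⟨K, hK⟩ := integral_arcChord_le_rpow (p := β - j) H.neg_one_lt (by linarith)
  refine IsBigO.of_bound (C * K) (eventually_principal.2 fun z hz => ?_)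
  have hz1 : z ≠ 1 := ne_of_mem_of_not_mem hz h1
  have hint := hK ‖1 - z‖ (norm_pos_iff.2 (sub_ne_zero.2 hz1.symm)) (hDπ z hz)
  rw [H.iteratedDeriv_spiralIntegral hD hDκ h1 j hz, Real.norm_of_nonneg (by positivity),
    mul_assoc, show α + β + 1 - j = α + (β - j) + 1 by ring]
  exact (hC z (hDκ hz) hz1).trans (by gcongr)

lemma isBigO_iteratedDeriv_spiralIntegral_log (H : SpiralData κ α β k g) (hD : IsOpen D)
    (hDκ : D ⊆ spiralClosure κ) (h1 : (1 : ℂ) ∉ D) {j : ℕ} (hj : α + β + 1 = j) :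
    iteratedDeriv j (spiralIntegral κ k g 0) =O[𝓟 D] fun z => 1 + |Real.log ‖1 - z‖| := by
  obtain ⟨C, hC0, hC⟩ := H.norm_spiralIntegral_le j
  obtain ⟨K, hK⟩ := integral_arcChord_le_log (p := β - j) H.neg_one_lt (by linarith)
  refine IsBigO.of_bound (C * K) (eventually_principal.2 fun z hz => ?_)
  have hz1 : z ≠ 1 := ne_of_mem_of_not_mem hz h1
  have hint := hK ‖1 - z‖ (norm_pos_iff.2 (sub_ne_zero.2 hz1.symm)) (hDπ z hz)
  rw [H.iteratedDeriv_spiralIntegral hD hDκ h1 j hz, Real.norm_of_nonneg (by positivity),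
    mul_assoc]
  exact (hC z (hDκ hz) hz1).trans (by gcongr)

end SpiralData

/-! ### Cauchy's formula through the singularity -/

lemma ball_subset_spiralDomain {κ : ℝ} (hκ : 0 ≤ κ) : Metric.ball 0 1 ⊆ spiralDomain κ := by
  intro z hz
  exact (mem_ball_zero_iff.1 hz).trans_le
    (Real.one_le_exp (mul_nonneg hκ (chord_nonneg z)))

/-- The logarithmic derivative `w' / w` of the parametrization `w = spiral κ`. -/
noncomputable def spiralLogDeriv (κ θ : ℝ) : ℂ := κ * Real.cos (θ / 2) + Complex.I

/-- The weight `f(w) w' / (2πi w)` of Cauchy's formula for the Taylor coefficients of `f` along the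
closed curve `w = spiral κ`. -/
noncomputable def spiralWeight (f : ℂ → ℂ) (κ θ : ℝ) : ℂ :=
  f (spiral κ θ) * spiralLogDeriv κ θ / (2 * Real.pi * Complex.I)

lemma continuous_spiralLogDeriv (κ : ℝ) : Continuous (spiralLogDeriv κ) := by
  unfold spiralLogDeriv; fun_prop

section cauchy

variable {f : ℂ → ℂ} {κ μ a : ℝ}

lemma norm_spiralLogDeriv_le (hκ : 0 ≤ κ) (hκ1 : κ ≤ 1) (θ : ℝ) : ‖spiralLogDeriv κ θ‖ ≤ 2 := by
  refine (norm_add_le _ _).trans ?_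
  rw [Complex.norm_I, norm_mul, Complex.norm_real, Complex.norm_real, Real.norm_of_nonneg hκ,
    Real.norm_eq_abs]
  linarith [mul_le_one₀ hκ1 (abs_nonneg _) (Real.abs_cos_le_one (θ / 2))]

lemma exp_add_mul_I_mem_spiralDomain {x θ : ℝ} (hθ : θ ∈ Set.Icc 0 (2 * Real.pi))
    (hx : x < μ * arcChord θ) : Complex.exp (x + θ * Complex.I) ∈ spiralDomain μ := by
  change _ < Real.exp _
  rw [chord_exp_add_mul_I x hθ]
  simpa [Complex.norm_exp] using hx

lemma exp_mul_spiral_eq (s κ θ : ℝ) :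
    Real.exp s * spiral κ θ =
      Complex.exp ((s + κ * arcChord θ : ℝ) + θ * Complex.I) := by
  rw [spiral, Complex.ofReal_exp, ← Complex.exp_add]
  push_cast
  ring_nf

lemma spiral_mem_spiralDomain (hκμ : κ < μ) {θ : ℝ} (hθ : θ ∈ Set.Ioo 0 (2 * Real.pi)) :
    spiral κ θ ∈ spiralDomain μ := by
  have := exp_add_mul_I_mem_spiralDomain (Set.Ioo_subset_Icc_self hθ)
    (mul_lt_mul_of_pos_right hκμ (arcChord_pos hθ))
  rwa [Complex.ofReal_mul] at this

lemma exp_mul_spiral_mem_spiralDomain (hκμ : κ ≤ μ) {s : ℝ} (hs : s < 0) {θ : ℝ}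
    (hθ : θ ∈ Set.Icc 0 (2 * Real.pi)) : Real.exp s * spiral κ θ ∈ spiralDomain μ := by
  rw [exp_mul_spiral_eq]
  refine exp_add_mul_I_mem_spiralDomain hθ ?_
  linarith [mul_le_mul_of_nonneg_right hκμ (arcChord_nonneg hθ)]

lemma integral_circle_eq_taylorCoeff (hf : DifferentiableOn ℂ f (Metric.ball 0 1)) {s : ℝ}
    (hs : s < 0) (n : ℕ) :
    ∫ θ in (0 : ℝ)..2 * Real.pi, f (Complex.exp (s + θ * Complex.I)) *
        (Complex.exp (s + θ * Complex.I))⁻¹ ^ n * Complex.I =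
      2 * Real.pi * Complex.I * taylorCoeff f n := by
  have hcauchy := (hf.mono (Metric.closedBall_subset_ball
    (Real.exp_lt_one_iff.2 hs))).circleIntegral_one_div_sub_center_pow_smul (Real.exp_pos s) n
  rw [taylorCoeff, ← mul_div_assoc, ← div_mul_eq_mul_div, ← smul_eq_mul (_ / _), ← hcauchy,
    circleIntegral]
  refine intervalIntegral.integral_congr fun θ _ => ?_
  have hw : Complex.exp (s + θ * Complex.I) = circleMap 0 (Real.exp s) θ := by
    simp [circleMap, Complex.exp_add]
  have hw0 : circleMap 0 (Real.exp s) θ ≠ 0 := hw ▸ Complex.exp_ne_zero _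
  simp only [hw, deriv_circleMap, smul_eq_mul, sub_zero, inv_pow]
  field_simp
  ring

lemma integral_exp_mul_spiral_eq_taylorCoeff (hκ : 0 ≤ κ) (hκμ : κ ≤ μ)
    (hf : AnalyticOnNhd ℂ f (spiralDomain μ)) (n : ℕ) {s : ℝ} (hs : s < 0) :
    ∫ θ in Set.Ioo 0 (2 * Real.pi), f (Real.exp s * spiral κ θ) *
        (Real.exp s * spiral κ θ)⁻¹ ^ n * spiralLogDeriv κ θ =
      2 * Real.pi * Complex.I * taylorCoeff f n := by
  have hmem : ∀ t ∈ Set.uIcc (0 : ℝ) 1, ∀ θ ∈ Set.uIcc 0 (2 * Real.pi),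
      Complex.exp (s + θ * Complex.I + t * (κ * arcChord θ)) ∈ spiralDomain μ := by
    intro t ht θ hθ
    rw [Set.uIcc_of_le zero_le_one] at ht
    rw [Set.uIcc_of_le (by positivity)] at hθ
    have := exp_mul_spiral_mem_spiralDomain
      ((mul_le_of_le_one_left hκ ht.2).trans hκμ) hs hθ
    rw [exp_mul_spiral_eq] at this
    convert this using 2
    push_cast
    ring
  have hdeform := integral_comp_add_mul_deriv_eq
    (Φ := fun u => f (Complex.exp u) * (Complex.exp u)⁻¹ ^ n)
    (p := fun θ => s + θ * Complex.I) (q := fun θ => κ * arcChord θ)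
    (p' := fun _ => Complex.I) (q' := fun θ => κ * Real.cos (θ / 2))
    (fun θ => by
      simpa using ((hasDerivAt_id θ).ofReal_comp.mul_const Complex.I).const_add (s : ℂ))
    (fun θ => (hasDerivAt_arcChord θ).ofReal_comp.const_mul _) (by fun_prop) (by fun_prop)
    (by simp [arcChord_zero]) (by simp [arcChord_two_pi])
    fun t ht θ hθ => ((hf _ (hmem t ht θ hθ)).comp analyticAt_cexp).mul
      ((analyticAt_cexp.inv (Complex.exp_ne_zero _)).pow n)
  rw [integral_circle_eq_taylorCoeff (hf.differentiableOn.mono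
    (ball_subset_spiralDomain (hκ.trans hκμ))) hs n] at hdeform
  rw [← integral_Ioc_eq_integral_Ioo, ← intervalIntegral.integral_of_le (by positivity), ← hdeform]
  refine intervalIntegral.integral_congr fun θ _ => ?_
  have hexp : Complex.exp (s + θ * Complex.I + κ * arcChord θ) = Real.exp s * spiral κ θ := by
    rw [exp_mul_spiral_eq]
    push_cast
    ring_nf
  simp only [hexp, spiralLogDeriv, add_comm]

lemma norm_exp_mul_spiral_bounds (hκ : 0 ≤ κ) (hκ1 : 2 * κ ≤ 1) {s : ℝ} (hs : s ∈ Set.Ioo (-1) 0)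
    {θ : ℝ} (hθ : θ ∈ Set.Ioo 0 (2 * Real.pi)) :
    arcChord θ / 2 ≤ ‖1 - Real.exp s * spiral κ θ‖ ∧
      ‖1 - Real.exp s * spiral κ θ‖ ≤ 4 ∧ ‖(Real.exp s * spiral κ θ)⁻¹‖ ≤ Real.exp 1 := by
  have hθ' := Set.Ioo_subset_Icc_self hθ
  have hs0 := arcChord_pos hθ
  have hexp : κ * arcChord θ ≤ 1 := by nlinarith [arcChord_le_two θ]
  have hnorm : ‖Real.exp s * spiral κ θ‖ = Real.exp (s + κ * arcChord θ) := by
    rw [exp_mul_spiral_eq, Complex.norm_exp]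
    simp
  refine ⟨?_, ?_, ?_⟩
  · have hchord := chord_le_two_mul_norm_one_sub (Real.exp s * spiral κ θ)
    rw [exp_mul_spiral_eq, chord_exp_add_mul_I _ hθ', ← exp_mul_spiral_eq] at hchord
    linarith
  · have hle : Real.exp (s + κ * arcChord θ) ≤ Real.exp 1 := Real.exp_le_exp.2 (by linarith [hs.2])
    refine (norm_sub_le _ _).trans ?_
    rw [norm_one, hnorm]
    linarith [Real.exp_one_lt_d9]
  · rw [norm_inv, hnorm, ← Real.exp_neg]
    have : 0 ≤ κ * arcChord θ := by positivity
    exact Real.exp_le_exp.2 (by linarith [hs.1])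

lemma norm_comp_exp_mul_spiral_le (hκ : 0 ≤ κ) (hκ1 : 2 * κ ≤ 1) (hκμ : κ < μ)
    (hfO : f =O[𝓟 (spiralDomain μ)] fun z : ℂ => ‖1 - z‖ ^ a) :
    ∃ C : ℝ, 0 < C ∧ ∀ s ∈ Set.Ioo (-1 : ℝ) 0, ∀ θ ∈ Set.Ioo 0 (2 * Real.pi),
      ‖f (Real.exp s * spiral κ θ)‖ ≤ C * ((arcChord θ / 2) ^ a + 4 ^ a) := by
  obtain ⟨C, hC, hbound⟩ := hfO.exists_pos
  rw [isBigOWith_principal] at hbound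
  refine ⟨C, hC, fun s hs θ hθ => ?_⟩
  have hsp := arcChord_pos hθ
  obtain ⟨hlow, hupp, -⟩ := norm_exp_mul_spiral_bounds hκ hκ1 hs hθ
  have h := hbound _
    (exp_mul_spiral_mem_spiralDomain hκμ.le hs.2 (Set.Ioo_subset_Icc_self hθ))
  rw [Real.norm_of_nonneg (by positivity)] at h
  exact h.trans (by gcongr; exact rpow_le_rpow_add_rpow (by positivity) hlow hupp a)

lemma tendsto_integral_exp_mul_spiral (hκ : 0 ≤ κ) (hκ1 : 2 * κ ≤ 1) (hκμ : κ < μ)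
    (ha : -1 < a) (hf : AnalyticOnNhd ℂ f (spiralDomain μ))
    (hfO : f =O[𝓟 (spiralDomain μ)] fun z : ℂ => ‖1 - z‖ ^ a) (n : ℕ) :
    Tendsto (fun s : ℝ => ∫ θ in Set.Ioo 0 (2 * Real.pi), f (Real.exp s * spiral κ θ) *
        (Real.exp s * spiral κ θ)⁻¹ ^ n * spiralLogDeriv κ θ) (𝓝[<] 0)
      (𝓝 (∫ θ in Set.Ioo 0 (2 * Real.pi),
        f (spiral κ θ) * (spiral κ θ)⁻¹ ^ n * spiralLogDeriv κ θ)) := by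
  obtain ⟨C, hC, hbound⟩ := norm_comp_exp_mul_spiral_le hκ hκ1 hκμ hfO
  have hcw := continuous_spiral κ
  have hI : ∀ᶠ s : ℝ in 𝓝[<] 0, s ∈ Set.Ioo (-1 : ℝ) 0 := Ioo_mem_nhdsLT (by norm_num)
  have hne : ∀ s θ : ℝ, Real.exp s * spiral κ θ ≠ 0 := fun s θ => by
    rw [exp_mul_spiral_eq]
    exact Complex.exp_ne_zero _
  refine tendsto_integral_filter_of_dominated_convergence
    (fun θ => C * ((1 / 2) ^ a * arcChord θ ^ a + 4 ^ a) * Real.exp 1 ^ n * 2) ?_ ?_ ?_ ?_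
  · filter_upwards [hI] with s hs
    refine ContinuousOn.aestronglyMeasurable ?_ measurableSet_Ioo
    have hcont : ContinuousOn (fun θ => Real.exp s * spiral κ θ) (Set.Ioo 0 (2 * Real.pi)) := by
      fun_prop
    exact ((hf.continuousOn.comp hcont fun θ hθ => exp_mul_spiral_mem_spiralDomain hκμ.le hs.2
      (Set.Ioo_subset_Icc_self hθ)).mul ((hcont.inv₀ fun θ _ => hne s θ).pow n)).mul
      (continuous_spiralLogDeriv κ).continuousOn
  · filter_upwards [hI] with s hs
    refine ae_restrict_of_forall_mem measurableSet_Ioo fun θ hθ => ?_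
    have hsp := arcChord_pos hθ
    rw [norm_mul, norm_mul, norm_pow]
    gcongr
    · rw [← Real.mul_rpow (by norm_num) hsp.le, one_div_mul_eq_div]
      exact hbound s hs θ hθ
    · exact (norm_exp_mul_spiral_bounds hκ hκ1 hs hθ).2.2
    · exact norm_spiralLogDeriv_le hκ (by linarith) θ
  · exact (((((integrableOn_arcChord_rpow ha).const_mul _).add
      (integrableOn_const measure_Ioo_lt_top.ne)).const_mul C).mul_const _).mul_const _
  · refine ae_restrict_of_forall_mem measurableSet_Ioo fun θ hθ => ?_
    have hcont : Tendsto (fun s : ℝ => (Real.exp s : ℂ) * spiral κ θ) (𝓝[<] 0)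
        (𝓝 (spiral κ θ)) := by
      have : ContinuousAt (fun s : ℝ => (Real.exp s : ℂ) * spiral κ θ) 0 := by fun_prop
      simpa [ContinuousAt] using this.tendsto.mono_left nhdsWithin_le_nhds
    exact (((hf _ (spiral_mem_spiralDomain hκμ hθ)).continuousAt.tendsto.comp hcont).mul
      ((hcont.inv₀ (spiral_ne_zero κ θ)).pow n)).mul tendsto_const_nhds

lemma integral_spiralWeight_eq_taylorCoeff (hκ : 0 ≤ κ) (hκ1 : 2 * κ ≤ 1) (hκμ : κ < μ)
    (ha : -1 < a) (hf : AnalyticOnNhd ℂ f (spiralDomain μ))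
    (hfO : f =O[𝓟 (spiralDomain μ)] fun z : ℂ => ‖1 - z‖ ^ a) (n : ℕ) :
    ∫ θ in Set.Ioo 0 (2 * Real.pi), spiralWeight f κ θ * (spiral κ θ)⁻¹ ^ n = taylorCoeff f n := by
  have hconst : Tendsto (fun s : ℝ => ∫ θ in Set.Ioo 0 (2 * Real.pi),
      f (Real.exp s * spiral κ θ) * (Real.exp s * spiral κ θ)⁻¹ ^ n * spiralLogDeriv κ θ) (𝓝[<] 0)
      (𝓝 (2 * Real.pi * Complex.I * taylorCoeff f n)) :=
    tendsto_const_nhds.congr' (eventually_mem_nhdsWithin.mono fun s hs =>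
      (integral_exp_mul_spiral_eq_taylorCoeff hκ hκμ.le hf n hs).symm)
  rw [← mul_right_inj' Complex.two_pi_I_ne_zero, ← tendsto_nhds_unique
    (tendsto_integral_exp_mul_spiral hκ hκ1 hκμ ha hf hfO n) hconst, ← integral_const_mul]
  refine integral_congr_ae (ae_of_all _ fun θ => ?_)
  simp only [spiralWeight]
  field_simp

lemma isBigO_spiralWeight (hκ : 0 ≤ κ) (hκ1 : 2 * κ ≤ 1) (hκμ : κ < μ)
    (hfO : f =O[𝓟 (spiralDomain μ)] fun z : ℂ => ‖1 - z‖ ^ a) :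
    spiralWeight f κ =O[𝓟 (Set.Ioo 0 (2 * Real.pi))] fun θ => arcChord θ ^ a := by
  have hmaps : Tendsto (spiral κ) (𝓟 (Set.Ioo 0 (2 * Real.pi))) (𝓟 (spiralDomain μ)) :=
    tendsto_principal_principal.2 fun θ hθ => spiral_mem_spiralDomain hκμ hθ
  have hcomp : (fun θ => ‖1 - spiral κ θ‖ ^ a) =O[𝓟 (Set.Ioo 0 (2 * Real.pi))]
      fun θ => arcChord θ ^ a := by
    refine IsBigO.of_bound ((2 : ℝ)⁻¹ ^ a + 2 ^ a) (eventually_principal.2 fun θ hθ => ?_)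
    have hs := arcChord_pos hθ
    have hθ' := Set.Ioo_subset_Icc_self hθ
    have hupp := norm_one_sub_le_two_mul_chord hκ hκ1 (norm_spiral_eq_exp_chord κ hθ')
    have hlow := chord_le_two_mul_norm_one_sub (spiral κ θ)
    rw [chord_spiral κ hθ'] at hupp hlow
    rw [Real.norm_of_nonneg (by positivity), Real.norm_of_nonneg (by positivity)]
    exact rpow_le_of_comparable two_pos hs hupp hlow a
  have hlog : spiralLogDeriv κ =O[𝓟 (Set.Ioo 0 (2 * Real.pi))] fun _ => (1 : ℝ) :=
    IsBigO.of_bound 2 (eventually_principal.2 fun θ _ => by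
      simpa using norm_spiralLogDeriv_le hκ (by linarith) θ)
  have hprod := ((hfO.comp_tendsto hmaps).trans hcomp).mul hlog
  simp only [mul_one] at hprod
  exact (hprod.const_mul_left (2 * Real.pi * Complex.I)⁻¹).congr_left fun θ => by
    rw [spiralWeight, div_eq_inv_mul, Function.comp_apply]

lemma continuousOn_spiralWeight (hκμ : κ < μ) (hf : ContinuousOn f (spiralDomain μ)) :
    ContinuousOn (spiralWeight f κ) (Set.Ioo 0 (2 * Real.pi)) :=
  ((hf.comp (continuous_spiral κ).continuousOn fun _ hθ => spiral_mem_spiralDomain hκμ hθ).mul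
    (continuous_spiralLogDeriv κ).continuousOn).div_const _

end cauchy

section hadamardProduct

variable {f g : ℂ → ℂ} {κ α β : ℝ}

lemma hasSum_taylorCoeff (hg : DifferentiableOn ℂ g (Metric.ball 0 1)) {z : ℂ} (hz : ‖z‖ < 1) :
    HasSum (fun n => taylorCoeff g n * z ^ n) (g z) := by
  refine (Complex.hasSum_taylorSeries_on_ball hg (mem_ball_zero_iff.2 hz)).congr_fun fun n => ?_
  simp only [taylorCoeff, sub_zero, smul_eq_mul]
  ring

lemma summable_norm_taylorCoeff_mul_pow (hg : DifferentiableOn ℂ g (Metric.ball 0 1)) {r : ℝ}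
    (hr0 : 0 ≤ r) (hr : r < 1) : Summable fun n => ‖taylorCoeff g n‖ * r ^ n := by
  have hs := (hasSum_taylorCoeff hg (z := r) (by simpa [abs_of_nonneg hr0])).summable.norm
  simpa [abs_of_nonneg hr0] using hs

lemma hasSum_spiralIntegrand_zero (hκ : 0 ≤ κ) (F : ℝ → ℂ)
    (hg : DifferentiableOn ℂ g (Metric.ball 0 1)) {z : ℂ} (hz : ‖z‖ < 1) {θ : ℝ}
    (hθ : θ ∈ Set.Ioo 0 (2 * Real.pi)) :
    HasSum (fun n => F θ * (spiral (2 * κ) θ)⁻¹ ^ n * (taylorCoeff g n * z ^ n))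
      (spiralIntegrand κ F g 0 z θ) := by
  have hdiv : ‖z / spiral (2 * κ) θ‖ < 1 := by
    rw [norm_div]
    exact (div_le_self (norm_nonneg _) (one_le_norm_spiral (by linarith)
      (Set.Ioo_subset_Icc_self hθ))).trans_lt hz
  rw [spiralIntegrand, pow_zero, mul_one, iteratedDeriv_zero]
  refine ((hasSum_taylorCoeff hg hdiv).mul_left (F θ)).congr_fun fun n => ?_
  rw [div_eq_mul_inv, mul_pow]
  ring

lemma hasSum_spiralIntegral (H : SpiralData κ α β (spiralWeight f (2 * κ)) g)
    (hf : ∀ n, ∫ θ in Set.Ioo 0 (2 * Real.pi),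
      spiralWeight f (2 * κ) θ * (spiral (2 * κ) θ)⁻¹ ^ n = taylorCoeff f n) {z : ℂ}
    (hz : ‖z‖ < 1) :
    HasSum (fun n => taylorCoeff f n * taylorCoeff g n * z ^ n)
      (spiralIntegral κ (spiralWeight f (2 * κ)) g 0 z) := by
  obtain ⟨K, -, hweight⟩ := H.isBigO_weight.exists_pos
  rw [isBigOWith_principal] at hweight
  have hκ := H.pos
  have hgd : DifferentiableOn ℂ g (Metric.ball 0 1) :=
    H.analytic.differentiableOn.mono (ball_subset_spiralDomain hκ.le)
  have key := hasSum_integral_of_dominated_convergence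
    (μ := volume.restrict (Set.Ioo 0 (2 * Real.pi)))
    (F := fun n θ => spiralWeight f (2 * κ) θ * (spiral (2 * κ) θ)⁻¹ ^ n *
      (taylorCoeff g n * z ^ n))
    (f := spiralIntegrand κ (spiralWeight f (2 * κ)) g 0 z)
    (fun n θ => K * arcChord θ ^ α * (‖taylorCoeff g n‖ * ‖z‖ ^ n)) ?_ ?_ ?_ ?_ ?_
  · refine key.congr_fun fun n => ?_
    rw [integral_mul_const, hf, mul_assoc]
  · exact fun n => ((H.continuousOn.mul (((continuous_spiral _).continuousOn.inv₀
      fun θ _ => spiral_ne_zero _ θ).pow n)).mul continuousOn_const).aestronglyMeasurable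
      measurableSet_Ioo
  · refine fun n => ae_restrict_of_forall_mem measurableSet_Ioo fun θ hθ => ?_
    have hs := arcChord_pos hθ
    have hinv := norm_spiral_inv_pow_le_one (mul_nonneg zero_le_two hκ.le)
      (Set.Ioo_subset_Icc_self hθ) n
    have hk := hweight θ hθ
    rw [Real.norm_of_nonneg (by positivity)] at hk
    rw [norm_mul, norm_mul, norm_mul, norm_pow z]
    refine mul_le_mul_of_nonneg_right ?_ (by positivity)
    exact (mul_le_of_le_one_right (norm_nonneg _) hinv).trans hk
  · exact ae_of_all _ fun θ =>
      (summable_norm_taylorCoeff_mul_pow hgd (norm_nonneg z) hz).mul_left _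
  · simp only [tsum_mul_left]
    exact ((integrableOn_arcChord_rpow H.neg_one_lt).const_mul K).mul_const _
  · exact ae_restrict_of_forall_mem measurableSet_Ioo fun θ hθ =>
      hasSum_spiralIntegrand_zero hκ.le _ hgd hz hθ

end hadamardProduct

/-! ### Taylor expansion at `1` -/

/-- A growth rate `B` on `(0, ∞)` that is controlled under dilations `x ↦ t * x`, `0 < t < 1`, by an
integrable function of `t`. Such a rate keeps its shape when a bound `xⁿ B(x)` is integrated
along a segment ending at the singularity. -/
structure HasIntegrableDilations (B : ℝ → ℝ) : Prop where
  nonneg : ∀ x, 0 < x → 0 ≤ B x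
  exists_bound : ∃ w : ℝ → ℝ, IntervalIntegrable w volume 0 1 ∧
    ∀ t ∈ Set.Ioo (0 : ℝ) 1, ∀ x, 0 < x → B (t * x) ≤ w t * B x

lemma hasIntegrableDilations_rpow {q : ℝ} (hq : -1 < q) :
    HasIntegrableDilations fun x => x ^ q where
  nonneg x hx := by positivity
  exists_bound := ⟨fun t => t ^ q, intervalIntegral.intervalIntegrable_rpow' hq,
    fun _ ht _ hx => (Real.mul_rpow ht.1.le hx.le).le⟩

lemma hasIntegrableDilations_log : HasIntegrableDilations fun x => 1 + |Real.log x| where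
  nonneg x _ := by positivity
  exists_bound := by
    refine ⟨fun t => 1 + |Real.log t|, intervalIntegrable_const.add
      intervalIntegral.intervalIntegrable_log'.abs, fun t ht x hx => ?_⟩
    rw [Real.log_mul ht.1.ne' hx.ne']
    linarith [abs_add_le (Real.log t) (Real.log x),
      mul_nonneg (abs_nonneg (Real.log t)) (abs_nonneg (Real.log x))]

section taylor

variable {D : Set ℂ} {B : ℝ → ℝ}

lemma norm_le_integral_of_tendsto_zero {ψ ψ' : ℂ → ℂ} {p z : ℂ} {b : ℝ → ℝ}
    (hseg : ∀ t ∈ Set.Ioc (0 : ℝ) 1, (AffineMap.lineMap p z t : ℂ) ∈ D)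
    (hψ : ∀ x ∈ D, HasDerivAt ψ (ψ' x) x) (hlim : Tendsto ψ (𝓝[D] p) (𝓝 0))
    (hb : IntervalIntegrable b volume 0 1)
    (hψ' : ∀ t ∈ Set.Ioo (0 : ℝ) 1, ‖ψ' (AffineMap.lineMap (k := ℝ) p z t)‖ * ‖z - p‖ ≤ b t) :
    ‖ψ z‖ ≤ ∫ t in (0 : ℝ)..1, b t := by
  set γ : ℝ →ᵃ[ℝ] ℂ := AffineMap.lineMap p z with hγ
  have hderiv : ∀ t ∈ Set.Ioc (0 : ℝ) 1, HasDerivAt (ψ ∘ γ) (ψ' (γ t) * (z - p)) t := fun t ht =>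
    (hψ _ (hseg t ht)).comp_of_eq t AffineMap.hasDerivAt_lineMap rfl
  set F : ℝ → ℂ := Function.update (ψ ∘ γ) 0 0
  have hF : ∀ t ∈ Set.Ioo (0 : ℝ) 1, HasDerivAt F (ψ' (γ t) * (z - p)) t := fun t ht =>
    (hderiv t (Set.Ioo_subset_Ioc_self ht)).congr_of_eventuallyEq
      ((eventually_ne_nhds ht.1.ne').mono fun _ hs => Function.update_of_ne hs _ _)
  have hIcc : Set.Icc (0 : ℝ) 1 \ {0} = Set.Ioc 0 1 := Set.Icc_sdiff_left
  have hcont : ContinuousOn F (Set.Icc 0 1) := by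
    rw [continuousOn_update_iff, hIcc]
    refine ⟨fun t ht => (hderiv t ht).continuousAt.continuousWithinAt, fun _ => hlim.comp ?_⟩
    refine tendsto_nhdsWithin_iff.2 ⟨?_, eventually_mem_nhdsWithin.mono hseg⟩
    have hγ0 : Tendsto γ (𝓝 0) (𝓝 (γ 0)) := AffineMap.lineMap_continuous.tendsto 0
    rw [hγ, AffineMap.lineMap_apply_zero] at hγ0
    exact hγ0.mono_left nhdsWithin_le_nhds
  have hle := norm_sub_le_integral_of_norm_deriv_le_of_le zero_le_one hcont
    (fun t ht => (hF t ht).differentiableAt.differentiableWithinAt)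
    (ae_of_all _ fun t ht => by
      rw [(hF t ht).deriv, norm_mul]
      exact hψ' t ht) hb
  simpa [F, γ] using hle

variable (h1 : (1 : ℂ) ∉ D) (hstar : ∀ z ∈ D, openSegment ℝ 1 z ⊆ D)
  (hB : HasIntegrableDilations B)
include h1 hstar hB

lemma isBigO_of_hasDerivAt_of_tendsto_zero {ψ ψ' : ℂ → ℂ} {n : ℕ}
    (hψ : ∀ z ∈ D, HasDerivAt ψ (ψ' z) z) (hlim : Tendsto ψ (𝓝[D] 1) (𝓝 0))
    (hψ' : ψ' =O[𝓟 D] fun z => ‖1 - z‖ ^ n * B ‖1 - z‖) :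
    ψ =O[𝓟 D] fun z => ‖1 - z‖ ^ (n + 1) * B ‖1 - z‖ := by
  obtain ⟨C, hC, hbound⟩ := hψ'.exists_pos
  rw [isBigOWith_principal] at hbound
  obtain ⟨w, hw, hdil⟩ := hB.exists_bound
  refine IsBigO.of_bound (C * ∫ t in (0 : ℝ)..1, w t) (eventually_principal.2 fun z hz => ?_)
  have hρ : 0 < ‖1 - z‖ := norm_pos_iff.2 (sub_ne_zero.2 (ne_of_mem_of_not_mem hz h1).symm)
  have hBρ := hB.nonneg _ hρ
  have hseg : ∀ t ∈ Set.Ioo (0 : ℝ) 1, (AffineMap.lineMap 1 z t : ℂ) ∈ D := fun t ht =>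
    hstar z hz (lineMap_mem_openSegment ℝ 1 z ht)
  have hnorm : ∀ t ∈ Set.Ioo (0 : ℝ) 1, ‖1 - (AffineMap.lineMap 1 z t : ℂ)‖ = t * ‖1 - z‖ := by
    intro t ht
    rw [← dist_eq_norm, dist_left_lineMap, Real.norm_of_nonneg ht.1.le, dist_eq_norm]
  rw [Real.norm_of_nonneg (by positivity), mul_right_comm,
    ← intervalIntegral.integral_const_mul]
  refine norm_le_integral_of_tendsto_zero (p := 1) (fun t ht => ?_) hψ hlim
    (hw.const_mul _) fun t ht => ?_
  · rcases ht.2.eq_or_lt with rfl | ht1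
    · rwa [AffineMap.lineMap_apply_one]
    · exact hseg t ⟨ht.1, ht1⟩
  · have hBt := hB.nonneg _ (mul_pos ht.1 hρ)
    have h := hbound _ (hseg t ht)
    rw [hnorm t ht, Real.norm_of_nonneg (by have := ht.1; positivity)] at h
    rw [norm_sub_rev z]
    calc _ ≤ C * ((t * ‖1 - z‖) ^ n * B (t * ‖1 - z‖)) * ‖1 - z‖ := by gcongr
      _ ≤ C * ((1 * ‖1 - z‖) ^ n * (w t * B ‖1 - z‖)) * ‖1 - z‖ := by
        have := ht.1
        have := ht.2
        gcongr
        exact hdil t ht _ hρ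
      _ = _ := by ring

omit h1 hstar hB in
lemma hasDerivAt_taylorPolyAtOne (d : ℕ → ℂ) (m : ℕ) (z : ℂ) :
    HasDerivAt (taylorPolyAtOne d (m + 1)) (taylorPolyAtOne (fun j => d (j + 1)) m z) z := by
  have hsplit : taylorPolyAtOne d (m + 1) = fun z => (∑ j ∈ Finset.range m,
      (-1) ^ (j + 1) / ((j + 1).factorial : ℂ) * d (j + 1) * (1 - z) ^ (j + 1)) + d 0 := by
    funext z
    rw [taylorPolyAtOne, Finset.sum_range_succ']
    simp
  rw [hsplit]
  refine HasDerivAt.add_const _ (HasDerivAt.fun_sum fun j _ => ?_)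
  refine ((((hasDerivAt_id' z).const_sub 1).pow (j + 1)).const_mul _).congr_deriv ?_
  have hfac : (j.factorial : ℂ) ≠ 0 := Nat.cast_ne_zero.2 j.factorial_ne_zero
  have hsucc : (j + 1 : ℂ) ≠ 0 := Nat.cast_add_one_ne_zero j
  rw [Nat.factorial_succ]
  push_cast
  field_simp
  ring

omit h1 hstar hB in
lemma taylorPolyAtOne_one (d : ℕ → ℂ) (m : ℕ) : taylorPolyAtOne d (m + 1) 1 = d 0 := by
  simp [taylorPolyAtOne, Finset.sum_range_succ']

lemma isBigO_sub_taylorPolyAtOne (M : ℕ) {h : ℂ → ℂ} {d : ℕ → ℂ} (hh : AnalyticOnNhd ℂ h D)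
    (hd : ∀ j < M, HasDerivValueAtOne h D j (d j))
    (hM : iteratedDeriv M h =O[𝓟 D] fun z => B ‖1 - z‖) :
    (fun z => h z - taylorPolyAtOne d M z) =O[𝓟 D] fun z => ‖1 - z‖ ^ M * B ‖1 - z‖ := by
  induction M generalizing h d with
  | zero => simpa [taylorPolyAtOne] using hM
  | succ M ih =>
    refine isBigO_of_hasDerivAt_of_tendsto_zero h1 hstar hB (fun z hz =>
      (hh z hz).differentiableAt.hasDerivAt.sub (hasDerivAt_taylorPolyAtOne d M z)) ?_
      (ih hh.deriv (fun j hj => ?_) ?_)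
    · have hh0 : Tendsto h (𝓝[D] 1) (𝓝 (d 0)) := by
        simpa only [HasDerivValueAtOne, iteratedDeriv_zero] using hd 0 M.succ_pos
      have hp0 := (hasDerivAt_taylorPolyAtOne d M 1).continuousAt.tendsto.mono_left
        (nhdsWithin_le_nhds (s := D))
      rw [taylorPolyAtOne_one] at hp0
      simpa using hh0.sub hp0
    · simpa only [HasDerivValueAtOne, iteratedDeriv_succ'] using hd (j + 1) (by omega)
    · rwa [iteratedDeriv_succ'] at hM

omit hstar hB in
lemma isBigO_log_norm_L {r : ℝ} (hr : 0 < r) :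
    (fun z => 1 + |Real.log ‖1 - z‖|) =O[𝓟 (D \ Metric.ball 0 r)] fun z => ‖L z‖ := by
  have hm : 0 < min 1 (r / 2) := by positivity
  refine IsBigO.of_bound ((min 1 (r / 2))⁻¹ + 1) (eventually_principal.2 fun z hz => ?_)
  have hz1 : 1 - z ≠ 0 := sub_ne_zero.2 (ne_of_mem_of_not_mem hz.1 h1).symm
  have hlog : |Real.log ‖1 - z‖| ≤ ‖L z‖ := by
    have := Complex.abs_re_le_norm (L z)
    rwa [L, Complex.log_re, norm_div, norm_one, one_div, Real.log_inv, abs_neg] at this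
  have hlow : min 1 (r / 2) ≤ ‖L z‖ := by
    rcases le_total 1 ‖L z‖ with hL | hL
    · exact (min_le_left _ _).trans hL
    · have hexp : Complex.exp (-L z) - 1 = -z := by
        rw [L, Complex.exp_neg, Complex.exp_log (one_div_ne_zero hz1), one_div, inv_inv]
        ring
      have hle := Complex.norm_exp_sub_one_le (x := -L z) (by rwa [norm_neg])
      rw [hexp, norm_neg, norm_neg] at hle
      have hrz : r ≤ ‖z‖ := by simpa using hz.2
      exact (min_le_right _ _).trans (by linarith)
  rw [norm_norm, Real.norm_of_nonneg (by positivity), add_mul, one_mul]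
  gcongr
  rwa [inv_mul_eq_div, one_le_div hm]

end taylor

/-! ### The singularity of the Hadamard product -/

/-- `h` has a singularity of order `s` at `1` in `D`: its derivatives of order less than `s` extend
to the point `1`, and those of order at least `s` are as large as those of `(1 - z) ^ s`, up to a
logarithm when the order equals `s`. -/
structure HasSingularOrder (h : ℂ → ℂ) (D : Set ℂ) (s : ℝ) : Prop where
  exists_hasDerivValueAtOne : ∃ d : ℕ → ℂ, ∀ j : ℕ, (j : ℝ) < s → HasDerivValueAtOne h D j (d j)
  isBigO_iteratedDeriv (j : ℕ) (hj : s < j) :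
    iteratedDeriv j h =O[𝓟 D] fun z : ℂ => ‖1 - z‖ ^ (s - j)
  isBigO_iteratedDeriv_log (j : ℕ) (hj : s = j) :
    iteratedDeriv j h =O[𝓟 D] fun z => 1 + |Real.log ‖1 - z‖|

namespace HasSingularOrder

variable {h : ℂ → ℂ} {D : Set ℂ} {s : ℝ}

lemma exists_isBigO_rpow (H : HasSingularOrder h D s) (hh : AnalyticOnNhd ℂ h D)
    (h1 : (1 : ℂ) ∉ D) (hstar : ∀ z ∈ D, openSegment ℝ 1 z ⊆ D) {M : ℕ} (hM : (M : ℝ) - 1 < s)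
    (hsM : s < M) :
    ∃ d : ℕ → ℂ, (∀ j < M, HasDerivValueAtOne h D j (d j)) ∧
      (fun z => h z - taylorPolyAtOne d M z) =O[𝓟 D] fun z => ‖1 - z‖ ^ s := by
  obtain ⟨d, hd⟩ := H.exists_hasDerivValueAtOne
  have hdM : ∀ j < M, HasDerivValueAtOne h D j (d j) := fun j hj => by
    have : (j : ℝ) + 1 ≤ M := by exact_mod_cast hj
    exact hd j (by linarith)
  refine ⟨d, hdM, (isBigO_sub_taylorPolyAtOne h1 hstar (hasIntegrableDilations_rpow (by linarith))
    M hh hdM (H.isBigO_iteratedDeriv M hsM)).trans_eventuallyEq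
      (eventually_principal.2 fun z hz => ?_)⟩
  have hz1 : 0 < ‖1 - z‖ := norm_pos_iff.2 (sub_ne_zero.2 (ne_of_mem_of_not_mem hz h1).symm)
  simp only [← Real.rpow_natCast, ← Real.rpow_add hz1, add_sub_cancel]

lemma exists_isBigO_log (H : HasSingularOrder h D s) (hh : AnalyticOnNhd ℂ h D)
    (h1 : (1 : ℂ) ∉ D) (hstar : ∀ z ∈ D, openSegment ℝ 1 z ⊆ D) {M : ℕ} (hsM : s = M) :
    ∃ d : ℕ → ℂ, (∀ j < M, HasDerivValueAtOne h D j (d j)) ∧ ∀ r : ℝ, 0 < r →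
      (fun z => h z - taylorPolyAtOne d M z)
        =O[𝓟 (D \ Metric.ball 0 r)] fun z => ‖1 - z‖ ^ s * ‖L z‖ := by
  obtain ⟨d, hd⟩ := H.exists_hasDerivValueAtOne
  have hdM : ∀ j < M, HasDerivValueAtOne h D j (d j) := fun j hj =>
    hd j (hsM ▸ Nat.cast_lt.2 hj)
  have hlog := isBigO_sub_taylorPolyAtOne h1 hstar hasIntegrableDilations_log M hh hdM
    (H.isBigO_iteratedDeriv_log M hsM)
  refine ⟨d, hdM, fun r hr => (hlog.mono (principal_mono.2 Set.sdiff_subset)).trans ?_⟩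
  simp only [hsM, Real.rpow_natCast]
  exact (isBigO_refl _ _).mul (isBigO_log_norm_L h1 hr)

end HasSingularOrder

lemma SpiralData.hasSingularOrder {κ α β : ℝ} {k : ℝ → ℂ} {g : ℂ → ℂ} {D : Set ℂ}
    (H : SpiralData κ α β k g) (hD : IsOpen D) (hDκ : D ⊆ spiralClosure κ) (h1 : (1 : ℂ) ∉ D)
    (hDπ : ∀ z ∈ D, ‖1 - z‖ ≤ Real.pi) :
    HasSingularOrder (spiralIntegral κ k g 0) D (α + β + 1) where
  exists_hasDerivValueAtOne := ⟨_, fun _ => H.hasDerivValueAtOne_spiralIntegral hD hDκ h1⟩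
  isBigO_iteratedDeriv _ := H.isBigO_iteratedDeriv_spiralIntegral hDπ hD hDκ h1
  isBigO_iteratedDeriv_log _ := H.isBigO_iteratedDeriv_spiralIntegral_log hDπ hD hDκ h1

lemma IsHadamardProductOn.symm {f g h : ℂ → ℂ} {D : Set ℂ} (H : IsHadamardProductOn f g h D) :
    IsHadamardProductOn g f h D where
  analytic := H.analytic
  hasSum z hz := by simpa only [mul_comm (taylorCoeff g _)] using H.hasSum z hz

variable {f g : ℂ → ℂ} {a b : ℝ}

lemma spiralData_spiralWeight {κ : ℝ} (hκ : 0 < κ) (hκ1 : 16 * κ ≤ 1) (ha : -1 < a)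
    (hf : AnalyticOnNhd ℂ f (spiralDomain (4 * κ)))
    (hg : AnalyticOnNhd ℂ g (coneDomain (16 * κ) (16 * κ)))
    (hfO : f =O[𝓟 (spiralDomain (4 * κ))] fun z => ‖1 - z‖ ^ a)
    (hgO : g =O[𝓟 (coneDomain (16 * κ) (16 * κ))] fun z => ‖1 - z‖ ^ b) :
    SpiralData κ a b (spiralWeight f (2 * κ)) g := by
  have hsub : spiralDomain κ ⊆ coneDomain (4 * κ) (4 * κ) :=
    spiralDomain_subset_coneDomain hκ.le (by linarith) le_rfl le_rfl
  have hball : ∀ z ∈ spiralDomain κ,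
      Metric.closedBall z (κ * ‖1 - z‖) ⊆ coneDomain (16 * κ) (16 * κ) := fun z hz =>
    closedBall_subset_coneDomain hκ.le (by linarith) (by nlinarith) (by nlinarith) (hsub hz)
  exact
    { pos := hκ
      four_mul_le_one := by linarith
      neg_one_lt := ha
      continuousOn := continuousOn_spiralWeight (by linarith) hf.continuousOn
      isBigO_weight := isBigO_spiralWeight (by linarith) (by linarith) (by linarith) hfO
      analytic := hg.mono (hsub.trans (coneDomain_mono (by linarith) (by linarith)))
      isBigO_iteratedDeriv := isBigO_iteratedDeriv_of_closedBall_subset hg.differentiableOn hgO hκ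
        (by linarith) (fun h => one_notMem_coneDomain _ _ (hsub h)) hball }

lemma exists_isHadamardProductOn_hasSingularOrder_of_neg_one_lt {c η : ℝ} (hc : 0 < c)
    (hη : 0 < η) (hf : AnalyticOnNhd ℂ f (coneDomain c η))
    (hg : AnalyticOnNhd ℂ g (coneDomain c η))
    (hfO : f =O[𝓟 (coneDomain c η)] fun z => ‖1 - z‖ ^ a)
    (hgO : g =O[𝓟 (coneDomain c η)] fun z => ‖1 - z‖ ^ b) (ha : -1 < a) :
    ∃ c' ∈ Set.Ioc 0 c, ∃ η' ∈ Set.Ioc 0 η, ∃ h : ℂ → ℂ,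
      IsHadamardProductOn f g h (coneDomain c' η') ∧
        HasSingularOrder h (coneDomain c' η') (a + b + 1) := by
  obtain ⟨κ, hκ, hκ1, hκc, hκη⟩ : ∃ κ, 0 < κ ∧ 16 * κ ≤ 1 ∧ 16 * κ ≤ c ∧ 16 * κ ≤ η :=
    ⟨min 1 (min c η) / 16, by positivity, by simp [mul_div_cancel₀]⟩
  have hcone := coneDomain_mono hκc hκη
  have hspiral : spiralDomain (4 * κ) ⊆ coneDomain c η :=
    spiralDomain_subset_coneDomain (by linarith) (by linarith) (by linarith) (by linarith)
  have hfμ := hf.mono hspiral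
  have hfOμ := hfO.mono (principal_mono.2 hspiral)
  have H := spiralData_spiralWeight hκ hκ1 ha hfμ (hg.mono hcone) hfOμ
    (hgO.mono (principal_mono.2 hcone))
  have hcoeff := integral_spiralWeight_eq_taylorCoeff (κ := 2 * κ) (by linarith) (by linarith)
    (by linarith) ha hfμ hfOμ
  have hD := isOpen_coneDomain (κ / 4) (κ ^ 2 / 4)
  have h1 := one_notMem_coneDomain (κ / 4) (κ ^ 2 / 4)
  have hDκ := coneDomain_subset_spiralClosure hκ (by linarith)
  refine ⟨κ / 4, ⟨by positivity, by linarith⟩, κ ^ 2 / 4, ⟨by positivity, by nlinarith⟩,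
    spiralIntegral κ (spiralWeight f (2 * κ)) g 0,
    ⟨H.analyticOnNhd_spiralIntegral hD hDκ h1,
      fun z hz => hasSum_spiralIntegral H hcoeff (mem_ball_zero_iff.1 hz)⟩,
    H.hasSingularOrder hD hDκ h1 fun z hz => ?_⟩
  have hz2 : ‖1 - z‖ ≤ 1 + ‖z‖ := by simpa using norm_sub_le 1 z
  have hzη : ‖z‖ < 1 + κ ^ 2 / 4 := hz.1
  nlinarith [Real.pi_gt_three]

lemma exists_isHadamardProductOn_hasSingularOrder {c η : ℝ} (hc : 0 < c) (hη : 0 < η)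
    (hf : AnalyticOnNhd ℂ f (coneDomain c η)) (hg : AnalyticOnNhd ℂ g (coneDomain c η))
    (hfO : f =O[𝓟 (coneDomain c η)] fun z => ‖1 - z‖ ^ a)
    (hgO : g =O[𝓟 (coneDomain c η)] fun z => ‖1 - z‖ ^ b) (hab : -1 < a + b + 1) :
    ∃ c' ∈ Set.Ioc 0 c, ∃ η' ∈ Set.Ioc 0 η, ∃ h : ℂ → ℂ,
      IsHadamardProductOn f g h (coneDomain c' η') ∧
        HasSingularOrder h (coneDomain c' η') (a + b + 1) := by
  rcases lt_or_ge (-1) a with ha | ha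
  · exact exists_isHadamardProductOn_hasSingularOrder_of_neg_one_lt hc hη hf hg hfO hgO ha
  · obtain ⟨c', hc', η', hη', h, hh, hord⟩ :=
      exists_isHadamardProductOn_hasSingularOrder_of_neg_one_lt hc hη hg hf hgO hfO (by linarith)
    exact ⟨c', hc', η', hη', h, hh.symm, add_comm b a ▸ hord⟩

end HadamardSing

open HadamardSing in
theorem mainTheorem3_general (f g : ℂ → ℂ) (φ η a b : ℝ) (hφ : 0 ≤ φ) (hφ2 : φ < Real.pi / 2)
    (hη : 0 < η) (hf : AnalyticOnNhd ℂ f (deltaDomain φ η))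
    (hg : AnalyticOnNhd ℂ g (deltaDomain φ η))
    (hfO : f =O[𝓟 (deltaDomain φ η)] fun z : ℂ => ‖1 - z‖ ^ a)
    (hgO : g =O[𝓟 (deltaDomain φ η)] fun z : ℂ => ‖1 - z‖ ^ b)
    (hab : -1 < a + b + 1) :
    ∃ (φ' η' : ℝ) (h : ℂ → ℂ),
      φ ≤ φ' ∧ φ' < Real.pi / 2 ∧ 0 < η' ∧ η' ≤ η ∧
      IsHadamardProductOn f g h (deltaDomain φ' η') ∧
      (∀ k : ℤ, -1 ≤ k → (k : ℝ) < a + b + 1 → a + b + 1 < (k : ℝ) + 1 →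
        ∃ d : ℕ → ℂ,
          (∀ j : ℕ, (j : ℤ) ≤ k → HasDerivValueAtOne h (deltaDomain φ' η') j (d j)) ∧
          (fun z => h z - taylorPolyAtOne d (k + 1).toNat z)
            =O[𝓟 (deltaDomain φ' η')] fun z : ℂ => ‖1 - z‖ ^ (a + b + 1)) ∧
      (∀ m : ℕ, a + b + 1 = (m : ℝ) →
        ∃ d : ℕ → ℂ,
          (∀ j : ℕ, j < m → HasDerivValueAtOne h (deltaDomain φ' η') j (d j)) ∧
          ∀ r : ℝ, 0 < r →
            (fun z => h z - taylorPolyAtOne d m z)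
              =O[𝓟 (deltaDomain φ' η' \ Metric.ball 0 r)]
                fun z : ℂ => ‖1 - z‖ ^ (a + b + 1) * ‖L z‖) := by
  rw [deltaDomain_eq_coneDomain hφ (by linarith)] at hf hg hfO hgO
  have hcos : 0 < Real.cos φ := Real.cos_pos_of_mem_Ioo ⟨by linarith, hφ2⟩
  obtain ⟨c, hc, η', hη', h, hh, hord⟩ :=
    exists_isHadamardProductOn_hasSingularOrder hcos hη hf hg hfO hgO hab
  have hcone : deltaDomain (Real.arccos c) η' = coneDomain c η' := by
    rw [deltaDomain_eq_coneDomain (Real.arccos_nonneg c) (Real.arccos_le_pi c),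
      Real.cos_arccos (by linarith [hc.1]) (hc.2.trans (Real.cos_le_one φ))]
  have hφ' : φ ≤ Real.arccos c := by
    simpa only [Real.arccos_cos hφ (by linarith)] using Real.antitone_arccos hc.2
  have h1 := one_notMem_coneDomain c η'
  have hstar := fun z => openSegment_one_subset_coneDomain (c := c) (z := z) hη'.1
  refine ⟨Real.arccos c, η', h, hφ', Real.arccos_lt_pi_div_two.2 hc.1, hη'.1, hη'.2, ?_⟩
  rw [hcone]
  refine ⟨hh, fun k hk hks hsk => ?_, fun m hm => hord.exists_isBigO_log hh.analytic h1 hstar hm⟩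
  have hM : (((k + 1).toNat : ℕ) : ℝ) = k + 1 := by
    exact_mod_cast Int.toNat_of_nonneg (show 0 ≤ k + 1 by omega)
  obtain ⟨d, hd, hO⟩ := hord.exists_isBigO_rpow hh.analytic h1 hstar (M := (k + 1).toNat)
    (by linarith) (by linarith)
  exact ⟨d, fun j hj => hd j (by omega), hO⟩

open HadamardSing in
theorem mainTheorem3 (f g : ℂ → ℂ) (φ η a b : ℝ)
    (hf : IsDeltaRegular f φ η) (hg : IsDeltaRegular g φ η)
    (hfO : f =O[𝓟 (deltaDomain φ η)] fun z : ℂ => ‖1 - z‖ ^ a)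
    (hgO : g =O[𝓟 (deltaDomain φ η)] fun z : ℂ => ‖1 - z‖ ^ b)
    (hab : -1 < a + b + 1) :
    ∃ (φ' η' : ℝ) (h : ℂ → ℂ),
      φ ≤ φ' ∧ φ' < Real.pi / 2 ∧ 0 < η' ∧ η' ≤ η ∧
      IsHadamardProductOn f g h (deltaDomain φ' η') ∧
      (∀ k : ℤ, -1 ≤ k → (k : ℝ) < a + b + 1 → a + b + 1 < (k : ℝ) + 1 →
        ∃ d : ℕ → ℂ,
          (∀ j : ℕ, (j : ℤ) ≤ k → HasDerivValueAtOne h (deltaDomain φ' η') j (d j)) ∧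
          (fun z => h z - taylorPolyAtOne d (k + 1).toNat z)
            =O[𝓟 (deltaDomain φ' η')] fun z : ℂ => ‖1 - z‖ ^ (a + b + 1)) ∧
      (∀ m : ℕ, a + b + 1 = (m : ℝ) →
        ∃ d : ℕ → ℂ,
          (∀ j : ℕ, j < m → HasDerivValueAtOne h (deltaDomain φ' η') j (d j)) ∧
          ∀ r : ℝ, 0 < r →
            (fun z => h z - taylorPolyAtOne d m z)
              =O[𝓟 (deltaDomain φ' η' \ Metric.ball 0 r)]
                fun z : ℂ => ‖1 - z‖ ^ (a + b + 1) * ‖L z‖) :=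
  mainTheorem3_general f g φ η a b hf.phi_pos.le hf.phi_lt hf.eta_pos hf.analytic hg.analytic
    hfO hgO hab
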